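/- Let $M$ be a smooth manifold of dimension $n$ (Hausdorff, second countable, without boundary, not necessarily compact, connected or orientable), let $\mathcal F$ be a smooth foliation of $M$, and let $\Omega^r(M)$ be the space of smooth real $r$-forms. The set of basic forms is $$\Omega_b^r(M)=\{\beta\in\Omega^r(M): X\lrcorner\beta=0,\ X\lrcorner d\beta=0 \text{ for every smooth vector field } X \text{ tangent to } \mathcal F\}.$$ For a Riemannian metric $g$ on $M$ let $*$ be the Hodge star operator and let $\delta=(-1)^{nk+n+1}*d*$ on $\Omega^k(M)$ be the codifferential (computed with local orientations, on which it does not depend; $\delta=0$ on $\Omega^0(M)$). The space of antibasic $r$-forms is $$\Omega_a^r(M,g)=\Big\{\alpha\in\Omega^r(M):\ \int_M\langle\alpha,\beta\rangle_g\,d\mathrm{vol}_g \text{ converges absolutely and equals } 0 \text{ for all } \beta\in\Omega_b^r(M)\Big\},$$ and the antibasic cohomology is $$H_a^r(M,\mathcal F,g)=\frac{\{\psi\in\Omega_a^r(M,g):\delta\psi=0\}}{\{\psi\in\Omega_a^r(M,g):\psi=\delta\varphi\text{ for some }\varphi\in\Omega_a^{r+1}(M,g)\}}.$$ Let $H_{a,c}^r(M,\mathcal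 F,g)$ be defined in the same way with $\Omega_a^\bullet(M,g)$ replaced throughout by its subspace of compactly supported forms. (If $M$ is compact, the two groups coincide.) Theorem. For any two Riemannian metrics $g,g'$ on $M$, with Hodge star operators $*,*'$ (for the same local orientations), let $B^r=*'\,*^{-1}$, a bundle map on $r$-forms, where $*,*'$ are taken from $(n-r)$-forms to $r$-forms. Then for every $r$ the map $B^r$ carries $\delta$-closed $g$-antibasic $r$-forms to $\delta'$-closed $g'$-antibasic $r$-forms, and $[\psi]\mapsto[B^r\psi]$ is a well-defined linear isomorphism $$H_a^r(M,\mathcal F,g)\;\cong\;H_a^r(M,\mathcal F,g').$$ The same holds for $H_{a,c}^r$. In particular, the isomorphism classes of these groups do not depend on the metric. -/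

import Mathlib

open scoped Manifold ContDiff Topology Bundle
open MeasureTheory

noncomputable section

namespace AntibasicCohomology

/-! ### Linear algebra of a scalar product on coordinate space -/

/-- The model space `ℝⁿ`. -/
abbrev Coord (n : ℕ) : Type := EuclideanSpace ℝ (Fin n)

/-- Alternating `r`-linear forms on `ℝⁿ`. -/
abbrev AltForm (n r : ℕ) : Type := Coord n [⋀^Fin r]→L[ℝ] ℝ

/-- The standard basis vector `e_i` of `ℝⁿ`. -/
abbrev stdVec {n : ℕ} (i : Fin n) : Coord n := EuclideanSpace.single i (1 : ℝ)

/-- The component `β^{f_1 … f_k}` of the form `β`, all indices being raised by the scalar product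
with Gram matrix `A`. -/
def raisedComponent {n k : ℕ} (A : Matrix (Fin n) (Fin n) ℝ) (β : AltForm n k)
    (f : Fin k → Fin n) : ℝ :=
  ∑ h : Fin k → Fin n, (∏ i, A⁻¹ (f i) (h i)) * β (fun i => stdVec (h i))

/-- The scalar product on `k`-forms induced by the scalar product with Gram matrix `A`:
`⟨α, β⟩ = (1/k!) ∑ α_{f_1 … f_k} β^{f_1 … f_k}`. -/
def formInner {n k : ℕ} (A : Matrix (Fin n) (Fin n) ℝ) (α β : AltForm n k) : ℝ :=
  (k.factorial : ℝ)⁻¹ *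
    ∑ f : Fin k → Fin n, α (fun i => stdVec (f i)) * raisedComponent A β f

lemma append_update {n k l : ℕ} (u : Fin k → Coord n) [DecidableEq (Fin l)]
    (v : Fin l → Coord n) (i : Fin l) (x : Coord n) :
    Fin.append u (Function.update v i x) =
      Function.update (Fin.append u v) (Fin.natAdd k i) x := by
  funext j
  refine Fin.addCases (fun a => ?_) (fun a => ?_) j
  · have : Fin.castAdd l a ≠ Fin.natAdd k i := by
      intro h
      have := congrArg Fin.val h
      simp at this
      omega
    simp [Function.update_of_ne this]
  · by_cases h : a = i
    · subst h; simp
    · have h' : Fin.natAdd k a ≠ Fin.natAdd k i := by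
        intro h''; exact h (by simpa [Fin.ext_iff] using h'')
      simp [Function.update_of_ne h, Function.update_of_ne h']

/-- The `l`-form `v ↦ det (u_1, …, u_k, v_1, …, v_l)` on `ℝⁿ`, where `k + l = n`. -/
def detForm {n k l : ℕ} (h : k + l = n) (u : Fin k → Coord n) : AltForm n l where
  toFun v := (EuclideanSpace.basisFun (Fin n) ℝ).toBasis.det
    fun i => Fin.append u v (Fin.cast h.symm i)
  map_update_add' v i x y := by
    subst h
    simp only [append_update, Fin.cast_eq_self, AlternatingMap.map_update_add]
  map_update_smul' v i c x := by
    subst h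
    simp only [append_update, Fin.cast_eq_self, AlternatingMap.map_update_smul]
  map_eq_zero_of_eq' v i j hv hij := by
    subst h
    refine AlternatingMap.map_eq_zero_of_eq _ _ (i := Fin.natAdd k i) (j := Fin.natAdd k j) ?_ ?_
    · simpa using hv
    · intro h; exact hij (by simpa [Fin.ext_iff] using h)
  cont := by
    subst h
    have h1 : Continuous fun v : Fin l → Coord (k + l) => Fin.append u v := by
      refine continuous_pi fun j => ?_
      refine Fin.addCases (fun a => ?_) (fun a => ?_) j
      · simpa using continuous_const
      · simpa using continuous_apply a
    change Continuous fun v : Fin l → Coord (k + l) =>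
      (EuclideanSpace.basisFun (Fin (k + l)) ℝ).toBasis.det (Fin.append u v)
    simp only [Module.Basis.det_apply]
    refine Continuous.matrix_det (continuous_matrix fun i j => ?_)
    simp only [Module.Basis.toMatrix_apply, OrthonormalBasis.coe_toBasis_repr_apply,
      EuclideanSpace.basisFun_repr]
    have h2 : Continuous fun v : Fin l → Coord (k + l) => Fin.append u v j :=
      (continuous_apply j).comp h1
    fun_prop

/-- The Hodge star operator from `k`-forms to `l`-forms, `k + l = n`, of `ℝⁿ` with its standard
orientation and with the scalar product with Gram matrix `A`:
`(⋆β)(v_1, …, v_l) = (1/k!) √(det A) ∑ β^{f_1 … f_k} det (e_{f_1}, …, e_{f_k}, v_1, …, v_l)`.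
It is the operator with `α ∧ ⋆β = ⟨α, β⟩ vol`. It is set to `0` if `k + l ≠ n`. -/
def hodgeStar {n : ℕ} (A : Matrix (Fin n) (Fin n) ℝ) (k l : ℕ) (β : AltForm n k) : AltForm n l :=
  if h : k + l = n then
    ((k.factorial : ℝ)⁻¹ * √A.det) •
      ∑ f : Fin k → Fin n, raisedComponent A β f • detForm h (fun i => stdVec (f i))
  else 0

lemma raisedComponent_add {n k : ℕ} (A : Matrix (Fin n) (Fin n) ℝ) (β γ : AltForm n k)
    (f : Fin k → Fin n) :
    raisedComponent A (β + γ) f = raisedComponent A β f + raisedComponent A γ f := by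
  simp [raisedComponent, mul_add, Finset.sum_add_distrib]

lemma raisedComponent_smul {n k : ℕ} (A : Matrix (Fin n) (Fin n) ℝ) (c : ℝ) (β : AltForm n k)
    (f : Fin k → Fin n) : raisedComponent A (c • β) f = c * raisedComponent A β f := by
  simp only [raisedComponent, ContinuousAlternatingMap.smul_apply, smul_eq_mul, Finset.mul_sum]
  exact Finset.sum_congr rfl fun h _ => by ring

lemma formInner_add {n k : ℕ} (A : Matrix (Fin n) (Fin n) ℝ) (α β γ : AltForm n k) :
    formInner A (α + β) γ = formInner A α γ + formInner A β γ := by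
  simp [formInner, add_mul, mul_add, Finset.sum_add_distrib]

lemma formInner_smul {n k : ℕ} (A : Matrix (Fin n) (Fin n) ℝ) (c : ℝ) (α γ : AltForm n k) :
    formInner A (c • α) γ = c * formInner A α γ := by
  simp only [formInner, ContinuousAlternatingMap.smul_apply, smul_eq_mul, Finset.mul_sum]
  exact Finset.sum_congr rfl fun h _ => by ring

lemma hodgeStar_add {n : ℕ} (A : Matrix (Fin n) (Fin n) ℝ) (k l : ℕ) (β γ : AltForm n k) :
    hodgeStar A k l (β + γ) = hodgeStar A k l β + hodgeStar A k l γ := by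
  unfold hodgeStar
  split_ifs
  · simp only [raisedComponent_add, add_smul, Finset.sum_add_distrib, smul_add]
  · simp

lemma hodgeStar_smul {n : ℕ} (A : Matrix (Fin n) (Fin n) ℝ) (k l : ℕ) (c : ℝ) (β : AltForm n k) :
    hodgeStar A k l (c • β) = c • hodgeStar A k l β := by
  unfold hodgeStar
  split_ifs
  · simp only [raisedComponent_smul, mul_smul c, ← Finset.smul_sum]
    rw [smul_comm c]
  · simp

lemma differentiableAt_finsetProd {n : ℕ} {ι : Type*} [Fintype ι] {a : ι → Coord n → ℝ}
    {y : Coord n} (ha : ∀ i, DifferentiableAt ℝ (a i) y) :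
    DifferentiableAt ℝ (fun z => ∏ i, a i z) y := by
  classical
  exact (HasFDerivAt.finsetProd fun i _ => (ha i).hasFDerivAt).differentiableAt

lemma differentiableAt_det {n : ℕ} {A : Coord n → Matrix (Fin n) (Fin n) ℝ} {y : Coord n}
    (hA : ∀ i j, DifferentiableAt ℝ (fun z => A z i j) y) :
    DifferentiableAt ℝ (fun z => (A z).det) y := by
  simp only [Matrix.det_apply]
  fun_prop

lemma differentiableAt_inv {n : ℕ} {A : Coord n → Matrix (Fin n) (Fin n) ℝ} {y : Coord n}
    (hA : ∀ i j, DifferentiableAt ℝ (fun z => A z i j) y) (hdet : (A y).det ≠ 0) (i j : Fin n) :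
    DifferentiableAt ℝ (fun z => (A z)⁻¹ i j) y := by
  simp only [Matrix.inv_def, Ring.inverse_eq_inv', Matrix.smul_apply, smul_eq_mul,
    Matrix.adjugate_apply]
  refine ((differentiableAt_det hA).inv hdet).mul (differentiableAt_det fun a b => ?_)
  by_cases h : a = j
  · subst h; simp
  · simpa [Matrix.updateRow_ne h] using hA a b

lemma differentiableAt_hodgeStar {n : ℕ} {A : Coord n → Matrix (Fin n) (Fin n) ℝ} {y : Coord n}
    {k : ℕ} (l : ℕ) {β : Coord n → AltForm n k}
    (hA : ∀ i j, DifferentiableAt ℝ (fun z => A z i j) y) (hdet : (A y).det ≠ 0)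
    (hβ : DifferentiableAt ℝ β y) :
    DifferentiableAt ℝ (fun z => hodgeStar (A z) k l (β z)) y := by
  unfold hodgeStar
  split_ifs
  · have h1 : DifferentiableAt ℝ (fun z => √(A z).det) y := (differentiableAt_det hA).sqrt hdet
    have h2 (f : Fin k → Fin n) : DifferentiableAt ℝ (fun z => raisedComponent (A z) (β z) f) y := by
      unfold raisedComponent
      refine DifferentiableAt.fun_sum fun h _ => DifferentiableAt.mul ?_ ?_
      · exact differentiableAt_finsetProd fun i => differentiableAt_inv hA hdet _ _
      · exact (ContinuousAlternatingMap.apply ℝ (Coord n) ℝ _).differentiableAt.comp y hβ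
    exact (h1.const_mul _).smul (DifferentiableAt.fun_sum fun f _ => (h2 f).smul_const _)
  · exact differentiableAt_const _

/-! ### Differential forms on a manifold

In this section the model space is an arbitrary normed space `E`. -/

section Forms

variable {E : Type*} [NormedAddCommGroup E] [NormedSpace ℝ E]
  {M : Type*} [TopologicalSpace M] [ChartedSpace E M]

variable (E M) in
/-- Fields of alternating `r`-linear forms on the tangent spaces of `M`, with no regularity. -/
def FormField (r : ℕ) : Type _ := ∀ x : M, TangentSpace 𝓘(ℝ, E) x [⋀^Fin r]→L[ℝ] ℝ

instance (r : ℕ) : AddCommGroup (FormField E M r) :=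
  inferInstanceAs (AddCommGroup (∀ x : M, TangentSpace 𝓘(ℝ, E) x [⋀^Fin r]→L[ℝ] ℝ))

instance (r : ℕ) : Module ℝ (FormField E M r) :=
  inferInstanceAs (Module ℝ (∀ x : M, TangentSpace 𝓘(ℝ, E) x [⋀^Fin r]→L[ℝ] ℝ))

lemma FormField.add_apply {r : ℕ} (η θ : FormField E M r) (x : M) : (η + θ) x = η x + θ x := rfl

lemma FormField.smul_apply {r : ℕ} (c : ℝ) (η : FormField E M r) (x : M) :
    (c • η) x = c • η x := rfl

lemma FormField.zero_apply {r : ℕ} (x : M) : (0 : FormField E M r) x = 0 := rfl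

/-- The derivative at `y` of the parametrization of `M` inverse to the chart at `x₀`. -/
def paramDeriv (x₀ : M) (y : E) :
    E →L[ℝ] TangentSpace 𝓘(ℝ, E) ((extChartAt 𝓘(ℝ, E) x₀).symm y) :=
  mfderiv 𝓘(ℝ, E) 𝓘(ℝ, E) (extChartAt 𝓘(ℝ, E) x₀).symm y

/-- The derivative at `x` of the chart at `x₀`. -/
def chartDeriv (x₀ x : M) : TangentSpace 𝓘(ℝ, E) x →L[ℝ] E :=
  mfderiv 𝓘(ℝ, E) 𝓘(ℝ, E) (extChartAt 𝓘(ℝ, E) x₀) x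

/-- The expression of a field of forms in the chart at `x₀` (its pullback to `E`). -/
def inChart {r : ℕ} (x₀ : M) (η : FormField E M r) (y : E) : E [⋀^Fin r]→L[ℝ] ℝ :=
  (η ((extChartAt 𝓘(ℝ, E) x₀).symm y)).compContinuousLinearMap (paramDeriv x₀ y)

lemma inChart_add {r : ℕ} (x₀ : M) (η θ : FormField E M r) :
    inChart x₀ (η + θ) = fun y => inChart x₀ η y + inChart x₀ θ y := by
  funext y; rfl

lemma inChart_smul {r : ℕ} (x₀ : M) (c : ℝ) (η : FormField E M r) :
    inChart x₀ (c • η) = fun y => c • inChart x₀ η y := by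
  funext y; rfl

lemma inChart_zero {r : ℕ} (x₀ : M) :
    inChart x₀ (0 : FormField E M r) = fun _ => 0 := by
  funext y; rfl

variable (E M) in
/-- The space `Ω^r(M)` of smooth differential `r`-forms. -/
def smoothForms (r : ℕ) : Submodule ℝ (FormField E M r) where
  carrier := {η | ∀ x₀ : M, ContDiffOn ℝ ∞ (inChart x₀ η) (extChartAt 𝓘(ℝ, E) x₀).target}
  add_mem' {η θ} hη hθ x₀ := by
    rw [inChart_add]
    exact (hη x₀).add (hθ x₀)
  zero_mem' x₀ := by
    rw [inChart_zero]
    exact contDiffOn_const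
  smul_mem' c η hη x₀ := by
    rw [inChart_smul]
    exact (hη x₀).const_smul c

variable (E M) in
/-- The forms that vanish outside of some compact set. -/
def compactlySupported (r : ℕ) : Submodule ℝ (FormField E M r) where
  carrier := {η | ∃ K : Set M, IsCompact K ∧ ∀ x ∉ K, η x = 0}
  add_mem' := by
    rintro η θ ⟨K, hK, hη⟩ ⟨L, hL, hθ⟩
    refine ⟨K ∪ L, hK.union hL, fun x hx => ?_⟩
    rw [FormField.add_apply, hη x (fun h => hx (Or.inl h)), hθ x (fun h => hx (Or.inr h)), add_zero]
  zero_mem' := ⟨∅, isCompact_empty, fun _ _ => rfl⟩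
  smul_mem' := by
    rintro c η ⟨K, hK, hη⟩
    refine ⟨K, hK, fun x hx => ?_⟩
    rw [FormField.smul_apply, hη x hx, smul_zero]

/-- The exterior derivative `d`, computed at `x` in the chart at `x`. -/
def extD {r : ℕ} (η : FormField E M r) : FormField E M (r + 1) := fun x =>
  (extDeriv (inChart x η) (extChartAt 𝓘(ℝ, E) x x)).compContinuousLinearMap (chartDeriv x x)

/-- The contraction `X ⌟ η` with a vector field, which is zero on `0`-forms. -/
def contraction (X : ∀ x : M, TangentSpace 𝓘(ℝ, E) x) :
    {r : ℕ} → FormField E M r → FormField E M (r - 1)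
  | 0, _ => 0
  | r + 1, η => fun x => ContinuousAlternatingMap.curryLeft (E := E) (n := r) (η x) (X x)

/-- Smooth vector fields. -/
def IsSmoothField (X : ∀ x : M, TangentSpace 𝓘(ℝ, E) x) [IsManifold 𝓘(ℝ, E) ∞ M] : Prop :=
  ContMDiff 𝓘(ℝ, E) 𝓘(ℝ, E).tangent ∞ fun x => (⟨x, X x⟩ : TangentBundle 𝓘(ℝ, E) M)

lemma differentiableAt_inChart {r : ℕ} {η : FormField E M r} (hη : η ∈ smoothForms E M r) (x : M) :
    DifferentiableAt ℝ (inChart x η) (extChartAt 𝓘(ℝ, E) x x) :=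
  ((hη x).contDiffAt (extChartAt_target_mem_nhds x)).differentiableAt (by simp)

variable [IsManifold 𝓘(ℝ, E) ∞ M]

variable (E M) in
/-- Riemannian metrics on the smooth manifold `M`. -/
abbrev Metric : Type _ :=
  Bundle.ContMDiffRiemannianMetric 𝓘(ℝ, E) ∞ E (fun x : M => TangentSpace 𝓘(ℝ, E) x)

lemma contDiffOn_metric (g : Metric E M) (x₀ : M) (v w : E) :
    ContDiffOn ℝ ∞ (fun y => g.inner ((extChartAt 𝓘(ℝ, E) x₀).symm y)
      (paramDeriv x₀ y v) (paramDeriv x₀ y w)) (extChartAt 𝓘(ℝ, E) x₀).target := by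
  have hopen : IsOpen (extChartAt 𝓘(ℝ, E) x₀).target := isOpen_extChartAt_target x₀
  have hsymm : ContMDiffOn 𝓘(ℝ, E) 𝓘(ℝ, E) ∞ (extChartAt 𝓘(ℝ, E) x₀).symm
      (extChartAt 𝓘(ℝ, E) x₀).target := contMDiffOn_extChartAt_symm x₀
  have := IsManifold.of_le (I := 𝓘(ℝ, E)) (M := M) (m := 1) (n := ∞) (by simp)
  have hT := hsymm.contMDiffOn_tangentMapWithin (m := ∞) (by simp) hopen.uniqueMDiffOn
  have hvec (u : E) : ContMDiffOn 𝓘(ℝ, E) 𝓘(ℝ, E).tangent ∞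
      (fun y => (⟨(extChartAt 𝓘(ℝ, E) x₀).symm y, paramDeriv x₀ y u⟩ :
        TangentBundle 𝓘(ℝ, E) M)) (extChartAt 𝓘(ℝ, E) x₀).target := by
    have hc : ContMDiff 𝓘(ℝ, E) 𝓘(ℝ, E).tangent ∞
        (fun y : E => (⟨y, u⟩ : TangentBundle 𝓘(ℝ, E) E)) :=
      contMDiff_vectorSpace_iff_contDiff.2 contDiff_const
    refine (hT.comp hc.contMDiffOn (fun y hy => hy)).congr fun y hy => ?_
    simp only [Function.comp, tangentMapWithin, paramDeriv]
    rw [mfderivWithin_of_isOpen hopen hy]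
    rfl
  have hg := g.contMDiff.comp_contMDiffOn hsymm
  have h := ContMDiffOn.clm_bundle_apply₂ (F₁ := E) (F₂ := E) (F₃ := ℝ)
    (E₃ := Bundle.Trivial M ℝ) hg (hvec v) (hvec w)
  intro y hy
  have h' := h y hy
  rw [Bundle.contMDiffWithinAt_totalSpace] at h'
  exact h'.2.contDiffWithinAt

lemma paramDeriv_injective (x₀ : M) {y : E} (hy : y ∈ (extChartAt 𝓘(ℝ, E) x₀).target) {v : E}
    (hv : paramDeriv x₀ y v = 0) : v = 0 := by
  have := IsManifold.of_le (I := 𝓘(ℝ, E)) (M := M) (m := 1) (n := ∞) (by simp)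
  have h := mfderiv_extChartAt_comp_mfderivWithin_extChartAt_symm (I := 𝓘(ℝ, E)) hy
  rw [modelWithCornersSelf_coe, Set.range_id, mfderivWithin_univ] at h
  have h2 := DFunLike.congr_fun h v
  change _ = v at h2
  rw [← h2]
  change mfderiv 𝓘(ℝ, E) 𝓘(ℝ, E) (extChartAt 𝓘(ℝ, E) x₀) ((extChartAt 𝓘(ℝ, E) x₀).symm y)
    (paramDeriv x₀ y v) = 0
  rw [hv, map_zero]

end Forms

/-! ### Operators of a Riemannian metric -/

section Riemannian

variable {n : ℕ} {M : Type*} [TopologicalSpace M] [ChartedSpace (Coord n) M]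
  [IsManifold 𝓘(ℝ, Coord n) ∞ M]

/-- The Gram matrix `g(∂_i, ∂_j)` of the metric in the chart at `x₀`. -/
def metricInChart (g : Metric (Coord n) M) (x₀ : M) (y : Coord n) : Matrix (Fin n) (Fin n) ℝ :=
  Matrix.of fun i j => g.inner ((extChartAt 𝓘(ℝ, Coord n) x₀).symm y)
    (paramDeriv x₀ y (stdVec i)) (paramDeriv x₀ y (stdVec j))

/-- The Gram matrix of the metric on `T_x M`, in the basis of `T_x M` given by the chart at `x`
(`TangentSpace 𝓘(ℝ, ℝⁿ) x` is `ℝⁿ`, identified with `T_x M` through the chart at `x`). -/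
def metricAt (g : Metric (Coord n) M) (x : M) : Matrix (Fin n) (Fin n) ℝ :=
  Matrix.of fun i j => g.inner x (stdVec i : Coord n) (stdVec j : Coord n)

lemma differentiableAt_metricInChart (g : Metric (Coord n) M) (x : M) (i j : Fin n) :
    DifferentiableAt ℝ (fun y => metricInChart g x y i j) (extChartAt 𝓘(ℝ, Coord n) x x) :=
  ((contDiffOn_metric g x (stdVec i) (stdVec j)).contDiffAt
    (extChartAt_target_mem_nhds x)).differentiableAt (by simp)

lemma det_metricInChart_ne_zero (g : Metric (Coord n) M) (x₀ : M) {y : Coord n}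
    (hy : y ∈ (extChartAt 𝓘(ℝ, Coord n) x₀).target) : (metricInChart g x₀ y).det ≠ 0 := by
  intro h
  obtain ⟨v, hv, h0⟩ := Matrix.exists_mulVec_eq_zero_iff.2 h
  set p := (extChartAt 𝓘(ℝ, Coord n) x₀).symm y
  set w : Coord n := ∑ j, v j • stdVec j with hw
  have hz (i : Fin n) :
      g.inner p (paramDeriv x₀ y (stdVec i)) (paramDeriv x₀ y w) = 0 := by
    have := congrFun h0 i
    simp only [Matrix.mulVec, dotProduct, metricInChart, Matrix.of_apply, Pi.zero_apply] at this
    rw [hw, map_sum, map_sum, ← this]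
    refine Finset.sum_congr rfl fun j _ => ?_
    rw [map_smul, map_smul, smul_eq_mul, mul_comm]
  have hzz : g.inner p (paramDeriv x₀ y w) (paramDeriv x₀ y w) = 0 := by
    have hcomb : paramDeriv x₀ y w = ∑ j, v j • paramDeriv x₀ y (stdVec j) := by
      rw [hw, map_sum]
      exact Finset.sum_congr rfl fun j _ => map_smul _ _ _
    nth_rewrite 2 [hcomb]
    rw [map_sum]
    refine Finset.sum_eq_zero fun j _ => ?_
    rw [map_smul, g.symm, hz, smul_zero]
  have hw0 : w = 0 := by
    by_contra hne
    exact (g.pos p _ fun h => hne (paramDeriv_injective x₀ hy h)).ne' hzz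
  apply hv
  funext i
  have := congrArg (fun u : Coord n => u i) hw0
  simpa [hw, Pi.single_apply] using this

/-- The codifferential `δ = (-1)^{n k + n + 1} ⋆ d ⋆` on `k`-forms, `k = r + 1`, computed at `x` in
the chart at `x`, with the orientation of that chart. Since `⋆` enters twice, the result does not
depend on the orientation, and `M` need not be orientable. -/
def codiff (g : Metric (Coord n) M) {r : ℕ} (η : FormField (Coord n) M (r + 1)) :
    FormField (Coord n) M r := fun x =>
  ((-1 : ℝ) ^ (n * (r + 1) + n + 1) •
    hodgeStar (metricInChart g x (extChartAt 𝓘(ℝ, Coord n) x x)) (n - (r + 1) + 1) r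
      (extDeriv
        (fun y => hodgeStar (metricInChart g x y) (r + 1) (n - (r + 1)) (inChart x η y))
        (extChartAt 𝓘(ℝ, Coord n) x x))).compContinuousLinearMap (chartDeriv x x)

lemma codiff_add (g : Metric (Coord n) M) {r : ℕ} {η θ : FormField (Coord n) M (r + 1)}
    (hη : η ∈ smoothForms (Coord n) M (r + 1)) (hθ : θ ∈ smoothForms (Coord n) M (r + 1)) :
    codiff g (η + θ) = codiff g η + codiff g θ := by
  funext x
  have hd {ζ : FormField (Coord n) M (r + 1)} (hζ : ζ ∈ smoothForms (Coord n) M (r + 1)) :=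
    differentiableAt_hodgeStar (n - (r + 1)) (differentiableAt_metricInChart g x)
      (det_metricInChart_ne_zero g x (mem_extChartAt_target x)) (differentiableAt_inChart hζ x)
  simp only [codiff, inChart_add, hodgeStar_add, FormField.add_apply]
  rw [extDeriv_fun_add (hd hη) (hd hθ), hodgeStar_add, smul_add]
  rfl

lemma codiff_smul (g : Metric (Coord n) M) {r : ℕ} (c : ℝ) (η : FormField (Coord n) M (r + 1)) :
    codiff g (c • η) = c • codiff g η := by
  funext x
  simp only [codiff, inChart_smul, hodgeStar_smul, FormField.smul_apply]
  have h := extDeriv_smul (x := extChartAt 𝓘(ℝ, Coord n) x x) c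
    (fun y => hodgeStar (metricInChart g x y) (r + 1) (n - (r + 1)) (inChart x η y))
  rw [Pi.smul_def] at h
  rw [h, hodgeStar_smul, smul_comm]
  rfl

lemma codiff_zero (g : Metric (Coord n) M) (r : ℕ) :
    codiff g (0 : FormField (Coord n) M (r + 1)) = 0 := by
  simpa using codiff_smul g 0 (0 : FormField (Coord n) M (r + 1))

/-- The bundle map `B = ⋆' ⋆⁻¹` on `r`-forms, where `⋆` and `⋆'` are the Hodge star operators of `g`
and `g'` from `(n - r)`-forms to `r`-forms, for one and the same orientation of `T_x M`. -/
def starChange (g g' : Metric (Coord n) M) {r : ℕ} (η : FormField (Coord n) M r) :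
    FormField (Coord n) M r := fun x =>
  hodgeStar (metricAt g' x) (n - r) r
    (Function.invFun (hodgeStar (metricAt g x) (n - r) r) (η x))

/-- The pointwise scalar product of two forms. -/
def pointInner (g : Metric (Coord n) M) {r : ℕ} (α β : FormField (Coord n) M r) (x : M) : ℝ :=
  formInner (metricAt g x) (α x) (β x)

/-- The Riemannian volume of the domain of the chart at `x₀`: Lebesgue measure with density
`√(det g)`, transported to `M`. -/
def chartVolume [MeasurableSpace M] (g : Metric (Coord n) M) (x₀ : M) : Measure M :=
  ((volume.restrict (extChartAt 𝓘(ℝ, Coord n) x₀).target).withDensity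
    fun y => ENNReal.ofReal √(metricInChart g x₀ y).det).map (extChartAt 𝓘(ℝ, Coord n) x₀).symm

/-- The Riemannian volume measure. The measures `chartVolume g x₀` agree on the overlaps of the
charts, and their supremum is the measure that restricts to each of them. -/
def riemannianVolume [MeasurableSpace M] (g : Metric (Coord n) M) : Measure M :=
  ⨆ x₀ : M, chartVolume g x₀

/-- `α` and `β` are `L²`-orthogonal: the integral `⟨α, β⟩ = ∫_M ⟨α, β⟩_x dvol_g` converges
(absolutely) and is zero. -/
def L2Orthogonal [MeasurableSpace M] (g : Metric (Coord n) M) {r : ℕ}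
    (α β : FormField (Coord n) M r) : Prop :=
  Integrable (pointInner g α β) (riemannianVolume g) ∧
    ∫ x, pointInner g α β x ∂riemannianVolume g = 0

end Riemannian

/-! ### Foliations, basic and antibasic forms -/

/-- A smooth foliation with leaves of dimension `p` of an `n`-dimensional manifold, given by a
foliated atlas: the changes of coordinates are locally of the form `(x, y) ↦ (f(x, y), h(y))`, where
`y` stands for the last `n - p` coordinates. -/
structure Foliation (n p : ℕ) (M : Type*) [TopologicalSpace M] [ChartedSpace (Coord n) M] where
  dim_le : p ≤ n
  /-- The foliated charts. -/
  atlas : Set (OpenPartialHomeomorph M (Coord n))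
  smooth : ∀ e ∈ atlas, e ∈ IsManifold.maximalAtlas 𝓘(ℝ, Coord n) ∞ M
  covers : ∀ x : M, ∃ e ∈ atlas, x ∈ e.source
  compatible : ∀ e ∈ atlas, ∀ e' ∈ atlas, ∀ x ∈ e.source ∩ e'.source, ∃ U ∈ 𝓝 x,
    U ⊆ e.source ∩ e'.source ∧ ∀ y ∈ U, ∀ z ∈ U,
      (∀ i : Fin n, p ≤ (i : ℕ) → e y i = e z i) → ∀ i : Fin n, p ≤ (i : ℕ) → e' y i = e' z i

section Foliated

variable {n p : ℕ} {M : Type*} [TopologicalSpace M] [ChartedSpace (Coord n) M]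

/-- The derivative at `x` of a local chart of `M`. -/
def localChartDeriv {E : Type*} [NormedAddCommGroup E] [NormedSpace ℝ E] [ChartedSpace E M]
    (e : OpenPartialHomeomorph M E) (x : M) : TangentSpace 𝓘(ℝ, E) x →L[ℝ] E :=
  mfderiv 𝓘(ℝ, E) 𝓘(ℝ, E) e x

/-- The vector `v ∈ T_x M` is tangent to the leaf through `x`. -/
def Foliation.IsTangent (F : Foliation n p M) {x : M} (v : TangentSpace 𝓘(ℝ, Coord n) x) : Prop :=
  ∀ e ∈ F.atlas, x ∈ e.source → ∀ i : Fin n, p ≤ (i : ℕ) → localChartDeriv e x v i = 0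

variable [IsManifold 𝓘(ℝ, Coord n) ∞ M]

/-- The set `Ω_b^r(M)` of basic forms: the smooth forms `β` with `X ⌟ β = 0` and `X ⌟ dβ = 0` for
all smooth vector fields `X` tangent to the foliation. -/
def Foliation.basicForms (F : Foliation n p M) (r : ℕ) : Set (FormField (Coord n) M r) :=
  {β | β ∈ smoothForms (Coord n) M r ∧
    ∀ X : (∀ x : M, TangentSpace 𝓘(ℝ, Coord n) x), IsSmoothField X → (∀ x, F.IsTangent (X x)) →
      contraction X β = 0 ∧ contraction X (extD β) = 0}

/-- The space `Ω_a^r(M, g)` of antibasic forms: the smooth forms that are `L²`-orthogonal to all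
basic forms. -/
def Foliation.antibasicForms [MeasurableSpace M] (F : Foliation n p M) (g : Metric (Coord n) M)
    (r : ℕ) : Submodule ℝ (FormField (Coord n) M r) where
  carrier := {α | α ∈ smoothForms (Coord n) M r ∧ ∀ β ∈ F.basicForms r, L2Orthogonal g α β}
  add_mem' {α α'} hα hα' := by
    refine ⟨add_mem hα.1 hα'.1, fun β hβ => ?_⟩
    obtain ⟨h1, h2⟩ := hα.2 β hβ
    obtain ⟨h1', h2'⟩ := hα'.2 β hβ
    have h : pointInner g (α + α') β = fun x => pointInner g α β x + pointInner g α' β x := by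
      funext x
      exact formInner_add _ _ _ _
    refine ⟨h ▸ h1.add h1', ?_⟩
    rw [h, integral_add h1 h1', h2, h2', add_zero]
  zero_mem' := by
    refine ⟨zero_mem _, fun β _ => ?_⟩
    have h : pointInner g 0 β = fun _ => 0 := by
      funext x
      have h0 := formInner_smul (metricAt g x) 0 (0 : AltForm n r) (β x)
      rw [zero_smul, zero_mul] at h0
      exact h0
    exact ⟨h ▸ integrable_zero _ _ _, by rw [h]; simp⟩
  smul_mem' c α hα := by
    refine ⟨Submodule.smul_mem _ c hα.1, fun β hβ => ?_⟩
    obtain ⟨h1, h2⟩ := hα.2 β hβ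
    have h : pointInner g (c • α) β = fun x => c * pointInner g α β x := by
      funext x
      exact formInner_smul _ _ _ _
    refine ⟨h ▸ h1.const_mul c, ?_⟩
    rw [h, integral_const_mul, h2, mul_zero]

/-- The space of compactly supported antibasic forms. -/
def Foliation.compactAntibasicForms [MeasurableSpace M] (F : Foliation n p M)
    (g : Metric (Coord n) M) (r : ℕ) : Submodule ℝ (FormField (Coord n) M r) :=
  F.antibasicForms g r ⊓ compactlySupported (Coord n) M r

/-! ### Cohomology of the codifferential -/

/-- The smooth `r`-forms with `δη = 0` (all of them if `r = 0`). -/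
def coclosedForms (g : Metric (Coord n) M) : (r : ℕ) → Submodule ℝ (FormField (Coord n) M r)
  | 0 => smoothForms (Coord n) M 0
  | r + 1 =>
    { carrier := {η | η ∈ smoothForms (Coord n) M (r + 1) ∧ codiff g η = 0}
      add_mem' := fun {η θ} hη hθ =>
        ⟨add_mem hη.1 hθ.1, by rw [codiff_add g hη.1 hθ.1, hη.2, hθ.2, add_zero]⟩
      zero_mem' := ⟨zero_mem _, codiff_zero g r⟩
      smul_mem' := fun c η hη =>
        ⟨Submodule.smul_mem _ c hη.1, by rw [codiff_smul, hη.2, smul_zero]⟩ }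

/-- The forms `δη`, where `η` ranges over the smooth forms in `W`. -/
def codiffImage (g : Metric (Coord n) M) {r : ℕ}
    (W : Submodule ℝ (FormField (Coord n) M (r + 1))) :
    Submodule ℝ (FormField (Coord n) M r) where
  carrier := {θ | ∃ η ∈ W, η ∈ smoothForms (Coord n) M (r + 1) ∧ codiff g η = θ}
  add_mem' := by
    rintro _ _ ⟨η, hη, hs, rfl⟩ ⟨η', hη', hs', rfl⟩
    exact ⟨η + η', add_mem hη hη', add_mem hs hs', codiff_add g hs hs'⟩
  zero_mem' := ⟨0, zero_mem _, zero_mem _, codiff_zero g r⟩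
  smul_mem' := by
    rintro c _ ⟨η, hη, hs, rfl⟩
    exact ⟨c • η, W.smul_mem c hη, Submodule.smul_mem _ c hs, codiff_smul g c η⟩

variable (W : (r : ℕ) → Submodule ℝ (FormField (Coord n) M r))

/-- The `δ`-cocycles in a graded space `W` of forms. -/
def cocycles (g : Metric (Coord n) M) (r : ℕ) : Submodule ℝ (FormField (Coord n) M r) :=
  W r ⊓ coclosedForms g r

/-- The `δ`-cohomology of a graded space `W` of forms: the space of the `ψ ∈ W^r` with `δψ = 0`
modulo the space of those that are of the form `δφ` with `φ ∈ W^{r+1}`. -/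
abbrev Cohomology (g : Metric (Coord n) M) (r : ℕ) : Type _ :=
  cocycles W g r ⧸ (codiffImage g (W (r + 1))).comap (cocycles W g r).subtype

/-- The cohomology class of a cocycle. -/
def cohomologyClass (g : Metric (Coord n) M) (r : ℕ) : cocycles W g r →ₗ[ℝ] Cohomology W g r :=
  Submodule.mkQ _

end Foliated

/-- The antibasic cohomology `H_a^r(M, F, g)`. -/
abbrev antibasicCohomology {n p : ℕ} {M : Type*} [TopologicalSpace M] [ChartedSpace (Coord n) M]
    [IsManifold 𝓘(ℝ, Coord n) ∞ M] [MeasurableSpace M] (F : Foliation n p M)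
    (g : Metric (Coord n) M) (r : ℕ) : Type _ :=
  Cohomology (F.antibasicForms g) g r

/-- The antibasic cohomology with compact supports. -/
abbrev compactAntibasicCohomology {n p : ℕ} {M : Type*} [TopologicalSpace M]
    [ChartedSpace (Coord n) M] [IsManifold 𝓘(ℝ, Coord n) ∞ M] [MeasurableSpace M]
    (F : Foliation n p M) (g : Metric (Coord n) M) (r : ℕ) : Type _ :=
  Cohomology (F.compactAntibasicForms g) g r

end AntibasicCohomology

end

noncomputable section

namespace AntibasicCohomology

/-! ### Pullbacks of forms by matrices -/

/-! Write `⋆`, `⋆'` for the two star operators and `B = ⋆' ⋆⁻¹`. By definition `B ⋆ = ⋆'`. Since `⋆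
⋆` and `⋆' ⋆'` are the same sign, also `⋆' B = ⋆`. As `δ = ± ⋆ d ⋆` with a sign independent of the
metric, `δ' B = ± ⋆' d ⋆' B = ± ⋆' d ⋆ = ± B ⋆ d ⋆ = B δ`. Moreover `⟨Bα, β⟩' dvol' = β ∧ ⋆' B α = β
∧ ⋆ α = ⟨α, β⟩ dvol`, so `B` preserves orthogonality to any fixed set of forms. Basic forms are
defined without a metric; hence `B` maps antibasic forms to antibasic forms. It acts pointwise, so
it keeps compact supports, and its inverse is the same operator with the metrics exchanged. It is
thus an isomorphism of complexes.

The proof makes `B` explicit. For Gram matrices `A`, `A'` it is `gramChange`, the pullback by `A⁻¹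
A'` scaled by `√(det A / det A')`. The relations above become the matrix identities
`gramChange_hodgeStar`, `hodgeStar_gramChange` and `formInner_gramChange`, the first two resting on
`matPullback_stdStar`. `gramChange_conj` carries them to every chart, which gives smoothness and
`codiff_starChange`. On the side of measures, `riemannianVolume_eq_withDensity` compares the two
volumes, and `L2Orthogonal.starChange` follows. -/

/-- The pullback of a form on `ℝⁿ` by the endomorphism with matrix `L`. -/
def matPullback {n k : ℕ} (L : Matrix (Fin n) (Fin n) ℝ) (β : AltForm n k) : AltForm n k :=
  β.compContinuousLinearMap (Matrix.toEuclideanCLM (𝕜 := ℝ) L)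

lemma matPullback_apply {n k : ℕ} (L : Matrix (Fin n) (Fin n) ℝ) (β : AltForm n k)
    (v : Fin k → Coord n) :
    matPullback L β v = β fun i => Matrix.toEuclideanCLM (𝕜 := ℝ) L (v i) := rfl

lemma matPullback_mul {n k : ℕ} (L N : Matrix (Fin n) (Fin n) ℝ) (β : AltForm n k) :
    matPullback N (matPullback L β) = matPullback (L * N) β := by
  ext v
  simp only [matPullback_apply, map_mul]
  rfl

lemma matPullback_one {n k : ℕ} (β : AltForm n k) : matPullback 1 β = β := by
  ext v
  simp only [matPullback_apply, map_one]
  rfl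

lemma matPullback_smul {n k : ℕ} (L : Matrix (Fin n) (Fin n) ℝ) (c : ℝ) (β : AltForm n k) :
    matPullback L (c • β) = c • matPullback L β := rfl

lemma matPullback_add {n k : ℕ} (L : Matrix (Fin n) (Fin n) ℝ) (β γ : AltForm n k) :
    matPullback L (β + γ) = matPullback L β + matPullback L γ := rfl

lemma toEuclideanCLM_stdVec {n : ℕ} (L : Matrix (Fin n) (Fin n) ℝ) (j : Fin n) :
    Matrix.toEuclideanCLM (𝕜 := ℝ) L (stdVec j) = ∑ i, L i j • stdVec i := by
  ext a
  rw [Matrix.ofLp_toEuclideanCLM]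
  simp [Pi.single_apply, Finset.sum_apply]

/-- The expansion of an alternating map in the components of its arguments. -/
lemma map_sum_smul_stdVec {n k : ℕ} {V : Type*} [AddCommGroup V] [Module ℝ V]
    (β : Coord n [⋀^Fin k]→ₗ[ℝ] V) (L : Fin n → Fin n → ℝ) (f : Fin k → Fin n) :
    β (fun i => ∑ h, L (f i) h • stdVec h) =
      ∑ h : Fin k → Fin n, (∏ i, L (f i) (h i)) • β fun i => stdVec (h i) := by
  have h := β.toMultilinearMap.map_sum (fun i h => L (f i) h • (stdVec h : Coord n))
  simp only [AlternatingMap.coe_multilinearMap] at h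
  rw [h]
  refine Finset.sum_congr rfl fun h _ => ?_
  exact β.toMultilinearMap.map_smul_univ (fun i => L (f i) (h i)) (fun i => stdVec (h i))

lemma matPullback_stdVec {n k : ℕ} (L : Matrix (Fin n) (Fin n) ℝ) (β : AltForm n k)
    (f : Fin k → Fin n) :
    matPullback L β (fun i => stdVec (f i)) =
      ∑ h : Fin k → Fin n, (∏ i, L (h i) (f i)) * β fun i => stdVec (h i) := by
  simp only [matPullback_apply, toEuclideanCLM_stdVec]
  exact map_sum_smul_stdVec β.toAlternatingMap (fun a b => L b a) f

/-- Raising all indices amounts to pulling back by `A⁻¹`. Symmetry enters because the two sums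
contract opposite indices of `A⁻¹`. -/
lemma raisedComponent_eq {n k : ℕ} {A : Matrix (Fin n) (Fin n) ℝ} (hA : A.IsSymm)
    (β : AltForm n k) (f : Fin k → Fin n) :
    raisedComponent A β f = matPullback A⁻¹ β fun i => stdVec (f i) := by
  rw [matPullback_stdVec, raisedComponent]
  refine Finset.sum_congr rfl fun h _ => ?_
  congr 1
  refine Finset.prod_congr rfl fun i _ => ?_
  have hA' : (A⁻¹).IsSymm := by
    rw [Matrix.IsSymm, Matrix.transpose_nonsing_inv, hA.eq]
  exact (hA'.apply _ _).symm

/-- Forms on `ℝⁿ` agree if they agree on the increasing families of standard basis vectors. -/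
lemma ext_increasing {n k : ℕ} {α β : AltForm n k}
    (h : ∀ s : Set.powersetCard (Fin n) k,
      α (fun i => stdVec (Set.powersetCard.ofFinEmbEquiv.symm s i)) =
        β (fun i => stdVec (Set.powersetCard.ofFinEmbEquiv.symm s i))) : α = β := by
  apply ContinuousAlternatingMap.toAlternatingMap_injective
  -- As linear maps on the `k`-th exterior power, the forms are determined on its basis, which is
  -- indexed by the `k`-element subsets.
  apply exteriorPower.alternatingMapLinearEquiv.injective
  refine ((EuclideanSpace.basisFun (Fin n) ℝ).toBasis.exteriorPower k).ext fun s => ?_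
  rw [exteriorPower.basis_apply]
  simp only [exteriorPower.ιMulti_family, exteriorPower.alternatingMapLinearEquiv_apply_ιMulti]
  simpa [Function.comp_def] using h s

/-- There is no increasing family of `k > n` indices, so `ext_increasing` applies vacuously. -/
lemma altForm_subsingleton {n k : ℕ} (h : n < k) : Subsingleton (AltForm n k) := by
  refine ⟨fun α β => ext_increasing fun s => ?_⟩
  have := Fintype.card_le_of_injective _ (Set.powersetCard.ofFinEmbEquiv.symm s).injective
  simp at this
  omega

/-! ### The Hodge star operator of the standard scalar product -/

lemma detForm_apply {n k l : ℕ} (h : k + l = n) (u : Fin k → Coord n) (v : Fin l → Coord n) :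
    detForm h u v = (EuclideanSpace.basisFun (Fin n) ℝ).toBasis.det
      fun i => Fin.append u v (Fin.cast h.symm i) := rfl

lemma detForm_stdVec {n k l : ℕ} (h : k + l = n) (f : Fin k → Fin n) (g : Fin l → Fin n) :
    detForm h (fun i => stdVec (f i)) (fun i => stdVec (g i)) =
      (EuclideanSpace.basisFun (Fin n) ℝ).toBasis.det
        fun i => stdVec (Fin.append f g (Fin.cast h.symm i)) := by
  rw [detForm_apply]
  congr 1
  funext i
  generalize Fin.cast h.symm i = j
  refine Fin.addCases (fun a => ?_) (fun a => ?_) j <;> simp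

lemma injective_of_detForm_ne_zero {n k l : ℕ} (h : k + l = n) {f : Fin k → Fin n}
    {g : Fin l → Fin n}
    (hd : detForm h (fun i => stdVec (f i)) (fun i => stdVec (g i)) ≠ 0) :
    Function.Injective (Fin.append f g) := by
  rw [detForm_stdVec] at hd
  have hi : Function.Injective
      fun i => (stdVec (Fin.append f g (Fin.cast h.symm i)) : Coord n) := by
    by_contra hn
    exact hd (AlternatingMap.map_eq_zero_of_not_injective _ _ hn)
  intro a b hab
  have := @hi (Fin.cast h a) (Fin.cast h b) (by simp [hab])
  simpa using this

lemma detForm_ne_zero_of_injective {n k l : ℕ} (h : k + l = n) {f : Fin k → Fin n}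
    {g : Fin l → Fin n} (hi : Function.Injective (Fin.append f g)) :
    detForm h (fun i => stdVec (f i)) (fun i => stdVec (g i)) ≠ 0 := by
  rw [detForm_stdVec]
  subst h
  let σ : Equiv.Perm (Fin (k + l)) := Equiv.ofBijective _ (Finite.injective_iff_bijective.1 hi)
  have := (EuclideanSpace.basisFun (Fin (k + l)) ℝ).toBasis.det.map_perm
    (EuclideanSpace.basisFun (Fin (k + l)) ℝ).toBasis σ
  rw [Module.Basis.det_self] at this
  intro h0
  have h1 : (fun i => (stdVec (Fin.append f g (Fin.cast rfl i)) : Coord (k + l))) =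
      (EuclideanSpace.basisFun (Fin (k + l)) ℝ).toBasis ∘ σ := by
    funext i
    simp [σ]
  rw [h1, this] at h0
  rcases Int.units_eq_one_or (Equiv.Perm.sign σ) with hs | hs <;> simp [hs] at h0

/-- The Hodge star operator of the standard scalar product. -/
def stdStar {n k l : ℕ} (h : k + l = n) (β : AltForm n k) : AltForm n l :=
  (k.factorial : ℝ)⁻¹ •
    ∑ f : Fin k → Fin n, β (fun i => stdVec (f i)) • detForm h (fun i => stdVec (f i))

lemma stdStar_apply {n k l : ℕ} (h : k + l = n) (β : AltForm n k) (v : Fin l → Coord n) :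
    stdStar h β v = (k.factorial : ℝ)⁻¹ * ∑ f : Fin k → Fin n,
      β (fun i => stdVec (f i)) * detForm h (fun i => stdVec (f i)) v := by
  simp [stdStar, ContinuousAlternatingMap.sum_apply]

lemma stdStar_add {n k l : ℕ} (h : k + l = n) (β γ : AltForm n k) :
    stdStar h (β + γ) = stdStar h β + stdStar h γ := by
  simp [stdStar, add_smul, Finset.sum_add_distrib]

lemma stdStar_smul {n k l : ℕ} (h : k + l = n) (c : ℝ) (β : AltForm n k) :
    stdStar h (c • β) = c • stdStar h β := by
  simp only [stdStar, ContinuousAlternatingMap.smul_apply, smul_assoc, ← Finset.smul_sum]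
  rw [smul_comm]

/-- Exchanging the two groups of arguments of the determinant costs a sign. -/
lemma exists_detForm_swap {n k l : ℕ} (h : k + l = n) (h' : l + k = n) :
    ∃ ε : ℝ, ε ≠ 0 ∧ ∀ (u : Fin k → Coord n) (v : Fin l → Coord n),
      detForm h' v u = ε * detForm h u v := by
  let σ : Equiv.Perm (Fin n) := (finCongr h'.symm).trans (finAddFlip.trans (finCongr h))
  -- The sign is that of the block-exchanging permutation; only its being nonzero and independent of
  -- `u`, `v` is used later.
  refine ⟨((Equiv.Perm.sign σ : ℤ) : ℝ), by simp, fun u v => ?_⟩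
  have h1 : (fun i => Fin.append v u (Fin.cast h'.symm i)) =
      (fun i => Fin.append u v (Fin.cast h.symm i)) ∘ σ := by
    funext i
    obtain ⟨j, rfl⟩ := (finCongr h').surjective i
    refine Fin.addCases (fun a => ?_) (fun a => ?_) j <;> simp [σ]
  rw [detForm_apply, detForm_apply, h1, AlternatingMap.map_perm, Units.smul_def, zsmul_eq_mul]

/-- The forms `τ s`, with `s` an `l`-element set of indices, have images whose matrix of components
on the families `e t` is diagonal with nonzero diagonal. Any `l`-form is then a combination of these
images. -/
lemma stdStar_surjective {n k l : ℕ} (h : k + l = n) :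
    Function.Surjective (stdStar h) := by
  have h' : l + k = n := by omega
  obtain ⟨ε, hε, hswap⟩ := exists_detForm_swap h h'
  let e (s : Set.powersetCard (Fin n) l) : Fin l → Fin n := Set.powersetCard.ofFinEmbEquiv.symm s
  let τ (s : Set.powersetCard (Fin n) l) : AltForm n k := detForm h' fun i => stdVec (e s i)
  have hzero (s t : Set.powersetCard (Fin n) l) (hst : s ≠ t) :
      stdStar h (τ s) (fun i => stdVec (e t i)) = 0 := by
    rw [stdStar_apply, Finset.sum_eq_zero, mul_zero]
    intro f _
    by_contra hne
    obtain ⟨h1, h2⟩ := mul_ne_zero_iff.1 hne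
    have i1 : Function.Injective (Fin.append f (e s)) :=
      injective_of_detForm_ne_zero h (mul_ne_zero_iff.1 (hswap _ _ ▸ h1)).2
    have i2 := injective_of_detForm_ne_zero h h2
    -- A nonzero term forces both `s` and `t` to be the complement of the range of `f`, hence equal.
    have hr (u : Set.powersetCard (Fin n) l) (iu : Function.Injective (Fin.append f (e u))) :
        Set.range (e u) = (Set.range f)ᶜ := by
      ext x
      constructor
      · rintro ⟨j, rfl⟩ ⟨i, hij⟩
        exact (Fin.append_injective_iff.1 iu).2.2 i j hij
      · intro hx
        obtain ⟨j, rfl⟩ := ((Fintype.bijective_iff_injective_and_card _).2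
          ⟨iu, by simp [h]⟩).surjective x
        revert hx
        refine Fin.addCases (fun a => ?_) (fun a => ?_) j <;> simp
    have hrange : Set.range (e s) = Set.range (e t) := by rw [hr s i1, hr t i2]
    have hcoe (u : Set.powersetCard (Fin n) l) : Set.range (e u) = (u : Set (Fin n)) :=
      Finset.range_orderEmbOfFin u.1 u.2
    rw [hcoe, hcoe] at hrange
    exact hst (SetLike.coe_injective hrange)
  have hpos (s : Set.powersetCard (Fin n) l) :
      stdStar h (τ s) (fun i => stdVec (e s i)) ≠ 0 := by
    rw [stdStar_apply]
    -- Each term is `ε` times a square, so nothing cancels; enumerating the complement of `s` gives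
    -- a nonzero square.
    simp only [τ, hswap, mul_assoc, ← Finset.mul_sum]
    refine mul_ne_zero (by positivity) (mul_ne_zero hε ?_)
    obtain ⟨f, hf⟩ : ∃ f : Fin k → Fin n, Function.Injective (Fin.append f (e s)) := by
      have hc : (s.1ᶜ).card = k := by rw [Finset.card_compl, s.2, Fintype.card_fin]; omega
      refine ⟨(s.1ᶜ).orderEmbOfFin hc, Fin.append_injective_iff.2
        ⟨RelEmbedding.injective _, RelEmbedding.injective _, fun i j hij => ?_⟩⟩
      have h1 := Finset.orderEmbOfFin_mem (s.1ᶜ) hc i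
      rw [hij, Finset.mem_compl] at h1
      exact h1 (Finset.orderEmbOfFin_mem s.1 s.2 j)
    refine (Finset.sum_pos' (fun f _ => mul_self_nonneg _) ⟨f, Finset.mem_univ _, ?_⟩).ne'
    exact mul_self_pos.2 (detForm_ne_zero_of_injective h hf)
  intro α
  let S : AltForm n k →ₗ[ℝ] AltForm n l :=
    { toFun := stdStar h, map_add' := stdStar_add h, map_smul' := stdStar_smul h }
  refine ⟨∑ s, (α (fun i => stdVec (e s i)) / stdStar h (τ s) (fun i => stdVec (e s i))) • τ s, ?_⟩
  change S _ = α
  rw [map_sum]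
  refine ext_increasing fun t => ?_
  rw [ContinuousAlternatingMap.sum_apply, Finset.sum_eq_single t]
  · simp only [map_smul, ContinuousAlternatingMap.smul_apply, smul_eq_mul]
    exact div_mul_cancel₀ _ (hpos t)
  · intro s _ hst
    simp only [map_smul, ContinuousAlternatingMap.smul_apply, smul_eq_mul]
    exact mul_eq_zero_of_right _ (hzero s t hst)
  · simp

/-- The standard Hodge star operator intertwines pullbacks, up to the determinant. -/
lemma matPullback_stdStar {n k l : ℕ} (h : k + l = n) (L : Matrix (Fin n) (Fin n) ℝ)
    (β : AltForm n k) :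
    matPullback L (stdStar h (matPullback L.transpose β)) = L.det • stdStar h β := by
  ext v
  simp only [matPullback_apply, ContinuousAlternatingMap.smul_apply, smul_eq_mul]
  rw [stdStar_apply, stdStar_apply, mul_left_comm]
  congr 1
  simp only [matPullback_stdVec, Finset.sum_mul, Finset.mul_sum]
  rw [Finset.sum_comm]
  refine Finset.sum_congr rfl fun g _ => ?_
  obtain ⟨ε, hε, hswap⟩ := exists_detForm_swap h (by omega : l + k = n)
  let T := Matrix.toEuclideanCLM (𝕜 := ℝ) L
  -- The sum over `f` is the multilinear expansion of `det (L e_g, L v)` in its first group of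
  -- arguments. Since `detForm` is bundled as an alternating map in the second group only, the
  -- groups are exchanged, and `ε` is cancelled at the end.
  have h1 := map_sum_smul_stdVec (detForm (by omega : l + k = n) fun i => T (v i)).toAlternatingMap
    (fun a b => L b a) g
  have h2 : detForm h (fun i => T (stdVec (g i))) (fun i => T (v i)) =
      L.det * detForm h (fun i => stdVec (g i)) v := by
    have h3 := (EuclideanSpace.basisFun (Fin n) ℝ).toBasis.det_comp T.toLinearMap
      fun i => Fin.append (fun i => stdVec (g i)) v (Fin.cast h.symm i)
    have h4 : LinearMap.det T.toLinearMap = L.det := by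
      simp only [T, Matrix.coe_toEuclideanCLM_eq_toEuclideanLin]
      rw [Matrix.toEuclideanLin_eq_toLin_orthonormal, LinearMap.det_toLin]
    rw [h4] at h3
    rw [detForm_apply, detForm_apply, ← h3]
    congr 1
    funext i
    simp only [Function.comp_apply]
    generalize Fin.cast h.symm i = j
    refine Fin.addCases (fun a => ?_) (fun a => ?_) j <;> simp [T]
  simp only [ContinuousAlternatingMap.coe_toAlternatingMap, hswap, smul_eq_mul,
    ← toEuclideanCLM_stdVec] at h1
  change ε * detForm h (fun i => T (stdVec (g i))) (fun i => T (v i)) = _ at h1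
  rw [h2] at h1
  rw [mul_left_comm]
  refine mul_left_cancel₀ hε ?_
  rw [mul_left_comm ε, h1, Finset.mul_sum, Finset.mul_sum]
  refine Finset.sum_congr rfl fun f _ => ?_
  simp only [Matrix.transpose_apply]
  ring

/-! ### The change of scalar product -/

/-- The operator `α ↦ √(det A / det A') α ∘ A⁻¹A'` on forms on `ℝⁿ`. -/
def gramChange {n k : ℕ} (A A' : Matrix (Fin n) (Fin n) ℝ) (α : AltForm n k) : AltForm n k :=
  √(A.det / A'.det) • matPullback (A⁻¹ * A') α

section

variable {n k : ℕ} {A A' : Matrix (Fin n) (Fin n) ℝ}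

lemma gramChange_add (α β : AltForm n k) :
    gramChange A A' (α + β) = gramChange A A' α + gramChange A A' β := by
  simp [gramChange, matPullback_add]

lemma gramChange_smul (c : ℝ) (α : AltForm n k) :
    gramChange A A' (c • α) = c • gramChange A A' α := by
  simp only [gramChange, matPullback_smul]
  rw [smul_comm]

lemma gramChange_zero : gramChange A A' (0 : AltForm n k) = 0 := by
  simpa using gramChange_smul (A := A) (A' := A') 0 (0 : AltForm n k)

lemma gramChange_gramChange (hA : A.PosDef) (hA' : A'.PosDef) (α : AltForm n k) :
    gramChange A' A (gramChange A A' α) = α := by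
  have h1 := hA.det_pos
  have h2 := hA'.det_pos
  have h3 : (A⁻¹ * A') * (A'⁻¹ * A) = 1 := by
    rw [Matrix.mul_assoc, Matrix.mul_nonsing_inv_cancel_left _ _ h2.ne'.isUnit,
      Matrix.nonsing_inv_mul _ h1.ne'.isUnit]
  rw [gramChange, gramChange, matPullback_smul, matPullback_mul, h3, matPullback_one, smul_smul,
    ← Real.sqrt_mul (by positivity)]
  have : A'.det / A.det * (A.det / A'.det) = 1 := by field_simp
  simp [this]

/-- The operator `gramChange` does not depend on the choice of coordinates. -/
lemma gramChange_conj {P : Matrix (Fin n) (Fin n) ℝ} (hP : P.det ≠ 0)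
    (hA : A.det ≠ 0) (α : AltForm n k) :
    gramChange (P.transpose * A * P) (P.transpose * A' * P) (matPullback P α) =
      matPullback P (gramChange A A' α) := by
  have hP' : IsUnit P.transpose.det := by simpa using hP
  -- The endomorphism `A⁻¹ A'` is conjugated by `P`, while the factor `(det P)²` drops out of the
  -- ratio of determinants.
  have h1 : P * ((P.transpose * A * P)⁻¹ * (P.transpose * A' * P)) = A⁻¹ * A' * P := by
    rw [Matrix.mul_inv_rev, Matrix.mul_inv_rev]
    simp only [Matrix.mul_assoc]
    rw [Matrix.mul_nonsing_inv_cancel_left _ _ hP.isUnit,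
      Matrix.nonsing_inv_mul_cancel_left _ _ hP']
  have h2 : (P.transpose * A * P).det / (P.transpose * A' * P).det = A.det / A'.det := by
    simp only [Matrix.det_mul, Matrix.det_transpose]
    field_simp
  rw [gramChange, gramChange, matPullback_smul, matPullback_mul, matPullback_mul, h1, h2]

lemma formInner_eq (hA : A.IsSymm) (α β : AltForm n k) :
    formInner A α β = (k.factorial : ℝ)⁻¹ * ∑ f : Fin k → Fin n,
      α (fun i => stdVec (f i)) * matPullback A⁻¹ β (fun i => stdVec (f i)) := by
  simp only [formInner, raisedComponent_eq hA]

/-- Pullback by the transpose is the adjoint of pullback by `L` for the standard scalar product of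
components. -/
lemma sum_matPullback_mul (L : Matrix (Fin n) (Fin n) ℝ) (α β : AltForm n k) :
    ∑ f : Fin k → Fin n, matPullback L α (fun i => stdVec (f i)) * β (fun i => stdVec (f i)) =
      ∑ f : Fin k → Fin n,
        α (fun i => stdVec (f i)) * matPullback L.transpose β (fun i => stdVec (f i)) := by
  simp only [matPullback_stdVec, Finset.sum_mul, Finset.mul_sum]
  rw [Finset.sum_comm]
  refine Finset.sum_congr rfl fun f _ => Finset.sum_congr rfl fun g _ => ?_
  simp only [Matrix.transpose_apply]
  ring

lemma _root_.Matrix.PosDef.isSymm_real (hA : A.PosDef) : A.IsSymm := by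
  have h := hA.isHermitian.eq
  rwa [Matrix.conjTranspose_eq_transpose_of_trivial] at h

/-- Moved onto `β`, the pullback by `A⁻¹ A'` becomes the one by `A' A⁻¹`; combined with the index
raising by `A'⁻¹` it leaves the raising by `A⁻¹`. The remaining factor is the inverse ratio of the
volume densities. -/
lemma formInner_gramChange (hA : A.PosDef) (hA' : A'.PosDef) (α β : AltForm n k) :
    formInner A' (gramChange A A' α) β = √(A.det / A'.det) * formInner A α β := by
  have h3 : A'⁻¹ * (A⁻¹ * A').transpose = A⁻¹ := by
    rw [Matrix.transpose_mul, Matrix.transpose_nonsing_inv, hA.isSymm_real.eq,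
      hA'.isSymm_real.eq, Matrix.nonsing_inv_mul_cancel_left _ _ hA'.det_pos.ne'.isUnit]
  rw [gramChange, formInner_smul, formInner_eq hA'.isSymm_real, formInner_eq hA.isSymm_real,
    sum_matPullback_mul, matPullback_mul, h3]

lemma hodgeStar_of_add_eq {l : ℕ} (h : k + l = n) (hA : A.PosDef) (β : AltForm n k) :
    hodgeStar A k l β = √A.det • stdStar h (matPullback A⁻¹ β) := by
  simp only [hodgeStar, h, ↓reduceDIte, stdStar, smul_smul, raisedComponent_eq hA.isSymm_real]
  rw [mul_comm]

lemma hodgeStar_of_add_ne {l : ℕ} (h : k + l ≠ n) (β : AltForm n k) :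
    hodgeStar A k l β = 0 := by
  simp [hodgeStar, h]

/-- Instead of raising indices before the standard star, one may lower them after it, by
`matPullback_stdStar` with `L = A`. This form lets `gramChange` be composed on the left of the star,
and `hodgeStar_of_add_eq` on the right. -/
lemma hodgeStar_eq_matPullback {l : ℕ} (h : k + l = n) (hA : A.PosDef) (β : AltForm n k) :
    hodgeStar A k l β = (√A.det * A.det⁻¹) • matPullback A (stdStar h β) := by
  have h0 := hA.det_pos.ne'
  have h1 := matPullback_stdStar h A (matPullback A⁻¹ β)
  rw [hA.isSymm_real.eq, matPullback_mul, Matrix.nonsing_inv_mul _ h0.isUnit,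
    matPullback_one] at h1
  rw [hodgeStar_of_add_eq h hA, h1, smul_smul, mul_assoc, inv_mul_cancel₀ h0, mul_one]

/-- The operator `gramChange` is `⋆' ⋆⁻¹`. -/
lemma gramChange_hodgeStar {l : ℕ} (hA : A.PosDef) (hA' : A'.PosDef) (β : AltForm n k) :
    gramChange A A' (hodgeStar A k l β) = hodgeStar A' k l β := by
  by_cases h : k + l = n
  · have h1 := hA.det_pos
    have h2 := hA'.det_pos
    rw [hodgeStar_eq_matPullback h hA, hodgeStar_eq_matPullback h hA', gramChange_smul, gramChange,
      matPullback_mul, Matrix.mul_nonsing_inv_cancel_left _ _ h1.ne'.isUnit, smul_smul]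
    congr 1
    rw [Real.sqrt_div h1.le]
    have h3 := Real.sqrt_pos.2 h1
    have h4 := Real.sqrt_pos.2 h2
    field_simp
    rw [Real.sq_sqrt h1.le, Real.sq_sqrt h2.le]
  · rw [hodgeStar_of_add_ne h, hodgeStar_of_add_ne h, gramChange_zero]

/-- This is `⋆' B = ⋆`: the factor `A'` of the pullback cancels the raising by `A'⁻¹`, and the
square roots combine to `√(det A)`. -/
lemma hodgeStar_gramChange {l : ℕ} (hA : A.PosDef) (hA' : A'.PosDef) (β : AltForm n k) :
    hodgeStar A' k l (gramChange A A' β) = hodgeStar A k l β := by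
  by_cases h : k + l = n
  · have h1 := hA.det_pos
    have h2 := hA'.det_pos
    rw [hodgeStar_of_add_eq h hA, hodgeStar_of_add_eq h hA', gramChange, matPullback_smul,
      stdStar_smul, matPullback_mul, Matrix.mul_nonsing_inv_cancel_right _ _ h2.ne'.isUnit,
      smul_smul, Real.sqrt_div h1.le, mul_div_cancel₀ _ (Real.sqrt_pos.2 h2).ne']
  · rw [hodgeStar_of_add_ne h, hodgeStar_of_add_ne h]

lemma hodgeStar_surjective {l : ℕ} (h : k + l = n) (hA : A.PosDef) :
    Function.Surjective (hodgeStar A k l) := by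
  intro α
  have h0 := hA.det_pos
  have h1 : √A.det * A.det⁻¹ ≠ 0 :=
    mul_ne_zero (Real.sqrt_pos.2 h0).ne' (inv_ne_zero h0.ne')
  obtain ⟨β, hβ⟩ := stdStar_surjective h ((√A.det * A.det⁻¹)⁻¹ • matPullback A⁻¹ α)
  refine ⟨β, ?_⟩
  rw [hodgeStar_eq_matPullback h hA, hβ, matPullback_smul, matPullback_mul,
    Matrix.nonsing_inv_mul _ h0.ne'.isUnit, matPullback_one, smul_inv_smul₀ h1]

lemma hodgeStar_invFun_hodgeStar (hA : A.PosDef) (hA' : A'.PosDef) (α : AltForm n k) :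
    hodgeStar A' (n - k) k (Function.invFun (hodgeStar A (n - k) k) α) = gramChange A A' α := by
  by_cases h : n - k + k = n
  -- Surjectivity alone makes `Function.invFun` a right inverse of the star, which suffices.
  · conv_rhs => rw [← Function.rightInverse_invFun (hodgeStar_surjective h hA) α]
    rw [gramChange_hodgeStar hA hA']
  -- Here `k > n`: the subtraction `n - k` truncates to `0`, and all `k`-forms vanish.
  · have := altForm_subsingleton (n := n) (k := k) (by omega)
    exact Subsingleton.elim _ _

end

/-! ### Smoothness of forms and matrices in coordinates -/

/-- A field of forms on `ℝⁿ` is smooth if its components are. -/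
lemma contDiffOn_altForm {n k : ℕ} {s : Set (Coord n)} {α : Coord n → AltForm n k}
    (h : ∀ f : Fin k → Fin n, ContDiffOn ℝ ∞ (fun y => α y fun i => stdVec (f i)) s) :
    ContDiffOn ℝ ∞ α s := by
  let ev : AltForm n k →ₗ[ℝ] ((Fin k → Fin n) → ℝ) :=
    { toFun := fun β f => β fun i => stdVec (f i)
      map_add' := fun _ _ => rfl
      map_smul' := fun _ _ => rfl }
  have hev : LinearMap.ker ev = ⊥ :=
    LinearMap.ker_eq_bot.2 fun β γ hβγ => ext_increasing fun s => congrFun hβγ _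
  -- A linear left inverse on the finite-dimensional space of components is continuous, so it
  -- rebuilds the form smoothly from its components.
  obtain ⟨inv, hinv⟩ := ev.exists_leftInverse_of_injective hev
  have h1 : α = fun y => LinearMap.toContinuousLinearMap inv (ev (α y)) := by
    funext y
    exact (LinearMap.congr_fun hinv (α y)).symm
  rw [h1]
  exact (LinearMap.toContinuousLinearMap inv).contDiff.comp_contDiffOn
    (contDiffOn_pi.2 h)

lemma contDiffOn_component {n k : ℕ} {s : Set (Coord n)} {α : Coord n → AltForm n k}
    (h : ContDiffOn ℝ ∞ α s) (v : Fin k → Coord n) : ContDiffOn ℝ ∞ (fun y => α y v) s :=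
  (ContinuousAlternatingMap.apply ℝ (Coord n) ℝ v).contDiff.comp_contDiffOn h

lemma contDiffOn_det {n m : ℕ} {s : Set (Coord n)} {A : Coord n → Matrix (Fin m) (Fin m) ℝ}
    (hA : ∀ i j, ContDiffOn ℝ ∞ (fun y => A y i j) s) : ContDiffOn ℝ ∞ (fun y => (A y).det) s := by
  simp only [Matrix.det_apply]
  refine ContDiffOn.sum fun σ _ => ContDiffOn.const_smul _ ?_
  exact contDiffOn_prod fun i _ => hA _ _

lemma contDiffOn_inv {n m : ℕ} {s : Set (Coord n)} {A : Coord n → Matrix (Fin m) (Fin m) ℝ}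
    (hA : ∀ i j, ContDiffOn ℝ ∞ (fun y => A y i j) s) (hdet : ∀ y ∈ s, (A y).det ≠ 0)
    (i j : Fin m) : ContDiffOn ℝ ∞ (fun y => (A y)⁻¹ i j) s := by
  simp only [Matrix.inv_def, Ring.inverse_eq_inv', Matrix.smul_apply, smul_eq_mul,
    Matrix.adjugate_apply]
  refine ((contDiffOn_det hA).inv hdet).mul (contDiffOn_det fun a b => ?_)
  by_cases h : a = j
  · subst h; simpa using contDiffOn_const
  · simpa [Matrix.updateRow_ne h] using hA a b

lemma contDiffOn_gramChange {n k : ℕ} {s : Set (Coord n)}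
    {A A' : Coord n → Matrix (Fin n) (Fin n) ℝ} {α : Coord n → AltForm n k}
    (hA : ∀ i j, ContDiffOn ℝ ∞ (fun y => A y i j) s)
    (hA' : ∀ i j, ContDiffOn ℝ ∞ (fun y => A' y i j) s)
    (hdet : ∀ y ∈ s, (A y).det ≠ 0) (hdet' : ∀ y ∈ s, (A' y).det ≠ 0)
    (hα : ContDiffOn ℝ ∞ α s) :
    ContDiffOn ℝ ∞ (fun y => gramChange (A y) (A' y) (α y)) s := by
  refine ContDiffOn.smul (ContDiffOn.sqrt ?_ fun y hy => div_ne_zero (hdet y hy) (hdet' y hy))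
    (contDiffOn_altForm fun f => ?_)
  · exact (contDiffOn_det hA).div (contDiffOn_det hA') hdet'
  · simp only [matPullback_stdVec, Matrix.mul_apply]
    refine ContDiffOn.sum fun h _ => ContDiffOn.mul (contDiffOn_prod fun i _ => ?_)
      (contDiffOn_component hα _)
    exact ContDiffOn.sum fun j _ => (contDiffOn_inv hA hdet _ _).mul (hA' _ _)

section

variable {n : ℕ} {M : Type*} [TopologicalSpace M] [ChartedSpace (Coord n) M]

/-! ### Metrics in charts -/

/-- The matrix of `paramDeriv x₀ y`, where the tangent space of `M` is identified with `ℝⁿ`. -/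
def paramMatrix (x₀ : M) (y : Coord n) : Matrix (Fin n) (Fin n) ℝ :=
  (Matrix.toEuclideanCLM (n := Fin n) (𝕜 := ℝ)).symm (paramDeriv x₀ y : Coord n →L[ℝ] Coord n)

lemma toEuclideanCLM_paramMatrix (x₀ : M) (y : Coord n) :
    Matrix.toEuclideanCLM (𝕜 := ℝ) (paramMatrix x₀ y) =
      (paramDeriv x₀ y : Coord n →L[ℝ] Coord n) :=
  (Matrix.toEuclideanCLM (n := Fin n) (𝕜 := ℝ)).apply_symm_apply _

lemma inChart_eq {r : ℕ} (x₀ : M) (η : FormField (Coord n) M r) (y : Coord n) :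
    inChart x₀ η y =
      matPullback (paramMatrix x₀ y) (η ((extChartAt 𝓘(ℝ, Coord n) x₀).symm y)) := by
  have h (β : AltForm n r) (L : Matrix (Fin n) (Fin n) ℝ) (D : Coord n →L[ℝ] Coord n)
      (hD : Matrix.toEuclideanCLM (𝕜 := ℝ) L = D) :
      β.compContinuousLinearMap D = matPullback L β := by
    rw [matPullback, hD]
  exact h _ _ _ (toEuclideanCLM_paramMatrix x₀ y)

lemma paramDeriv_stdVec (x₀ : M) (y : Coord n) (j : Fin n) :
    (paramDeriv x₀ y (stdVec j) : Coord n) = ∑ i, paramMatrix x₀ y i j • (stdVec i : Coord n) := by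
  rw [← toEuclideanCLM_stdVec, toEuclideanCLM_paramMatrix]
  rfl

variable [IsManifold 𝓘(ℝ, Coord n) ∞ M]

lemma metricInChart_eq (g : Metric (Coord n) M) (x₀ : M) (y : Coord n) :
    metricInChart g x₀ y = (paramMatrix x₀ y).transpose *
      metricAt g ((extChartAt 𝓘(ℝ, Coord n) x₀).symm y) * paramMatrix x₀ y := by
  ext i j
  let G : Coord n →L[ℝ] Coord n →L[ℝ] ℝ := g.inner ((extChartAt 𝓘(ℝ, Coord n) x₀).symm y)
  change G (paramDeriv x₀ y (stdVec i) : Coord n) (paramDeriv x₀ y (stdVec j) : Coord n) =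
    ((paramMatrix x₀ y).transpose * Matrix.of (fun i j => G (stdVec i) (stdVec j)) *
      paramMatrix x₀ y) i j
  rw [paramDeriv_stdVec, paramDeriv_stdVec]
  simp only [map_sum, map_smul, sum_apply, smul_apply,
    Matrix.mul_apply, Matrix.transpose_apply, Matrix.of_apply, smul_eq_mul, Finset.sum_mul]
  exact Finset.sum_congr rfl fun a _ => by rw [mul_comm, Finset.sum_mul]

lemma metricAt_posDef (g : Metric (Coord n) M) (x : M) : (metricAt g x).PosDef := by
  let G : Coord n →L[ℝ] Coord n →L[ℝ] ℝ := g.inner x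
  have hG (v : Fin n → ℝ) : v ⬝ᵥ (metricAt g x).mulVec v =
      G (∑ i, v i • stdVec i) (∑ i, v i • stdVec i) := by
    simp only [map_sum, map_smul, sum_apply, smul_apply,
      smul_eq_mul, dotProduct, Matrix.mulVec, Finset.mul_sum]
    rw [Finset.sum_comm]
    refine Finset.sum_congr rfl fun i _ => Finset.sum_congr rfl fun j _ => ?_
    change v j * (G (stdVec j) (stdVec i) * v i) = _
    ring
  refine Matrix.PosDef.of_dotProduct_mulVec_pos ?_ fun v hv => ?_
  · ext i j
    exact g.symm x _ _
  · rw [star_trivial, hG]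
    refine g.pos x _ fun h => hv ?_
    funext i
    have h' : (∑ i, v i • stdVec i : Coord n) = 0 := h
    have := congrArg (fun u : Coord n => u i) h'
    simpa [Pi.single_apply] using this

lemma det_paramMatrix_ne_zero (x₀ : M) {y : Coord n}
    (hy : y ∈ (extChartAt 𝓘(ℝ, Coord n) x₀).target) : (paramMatrix x₀ y).det ≠ 0 := by
  intro h
  obtain ⟨v, hv, h0⟩ := Matrix.exists_mulVec_eq_zero_iff.2 h
  refine hv ?_
  have h1 : (paramDeriv x₀ y (WithLp.toLp 2 v) : Coord n) = 0 := by
    refine (DFunLike.congr_fun (toEuclideanCLM_paramMatrix x₀ y) (WithLp.toLp 2 v)).symm.trans ?_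
    rw [Matrix.toEuclideanCLM_toLp, h0]
    rfl
  simpa using paramDeriv_injective x₀ hy h1

lemma metricInChart_posDef (g : Metric (Coord n) M) (x₀ : M) {y : Coord n}
    (hy : y ∈ (extChartAt 𝓘(ℝ, Coord n) x₀).target) : (metricInChart g x₀ y).PosDef := by
  rw [metricInChart_eq, ← Matrix.conjTranspose_eq_transpose_of_trivial]
  refine (metricAt_posDef g _).conjTranspose_mul_mul_same ?_
  exact Matrix.mulVec_injective_iff_isUnit.2
    ((Matrix.isUnit_iff_isUnit_det _).2 (det_paramMatrix_ne_zero x₀ hy).isUnit)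

/-- The tangent space at `x` is modelled on `ℝⁿ` through the preferred chart at `x`, so that chart
has the identity as derivative there. -/
lemma chartDeriv_self (x : M) :
    (chartDeriv x x : Coord n →L[ℝ] Coord n) = ContinuousLinearMap.id ℝ (Coord n) := by
  have := IsManifold.of_le (I := 𝓘(ℝ, Coord n)) (M := M) (m := 1) (n := ∞) (by simp)
  have h := mfderiv_chartAt_eq_tangentCoordChange (I := 𝓘(ℝ, Coord n)) (mem_chart_source _ x)
  ext1 v
  exact (DFunLike.congr_fun h v).trans
    (tangentCoordChange_self (I := 𝓘(ℝ, Coord n)) (mem_extChartAt_source x))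

lemma paramMatrix_self (x : M) : paramMatrix x (extChartAt 𝓘(ℝ, Coord n) x x) = 1 := by
  have := IsManifold.of_le (I := 𝓘(ℝ, Coord n)) (M := M) (m := 1) (n := ∞) (by simp)
  have h := mfderiv_extChartAt_comp_mfderivWithin_extChartAt_symm (I := 𝓘(ℝ, Coord n))
    (mem_extChartAt_target (I := 𝓘(ℝ, Coord n)) x)
  rw [modelWithCornersSelf_coe, Set.range_id, mfderivWithin_univ] at h
  -- The base point, obtained by going to the chart and back, equals `x` only propositionally; it is
  -- replaced by a variable `p` so that it can be substituted.
  have key (p : M) (hp : p = x) (D : Coord n →L[ℝ] Coord n)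
      (hD : (chartDeriv x p : Coord n →L[ℝ] Coord n).comp D =
        ContinuousLinearMap.id ℝ (Coord n)) : D = ContinuousLinearMap.id ℝ (Coord n) := by
    subst hp
    rw [chartDeriv_self] at hD
    exact hD
  have h1 := key _ (extChartAt_to_inv (I := 𝓘(ℝ, Coord n)) x)
    (paramDeriv x (extChartAt 𝓘(ℝ, Coord n) x x)) h
  rw [paramMatrix, h1]
  exact map_one (Matrix.toEuclideanCLM (n := Fin n) (𝕜 := ℝ)).symm

lemma metricInChart_self (g : Metric (Coord n) M) (x : M) :
    metricInChart g x (extChartAt 𝓘(ℝ, Coord n) x x) = metricAt g x := by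
  rw [metricInChart_eq, paramMatrix_self, extChartAt_to_inv]
  simp

lemma contDiffOn_metricInChart (g : Metric (Coord n) M) (x₀ : M) (i j : Fin n) :
    ContDiffOn ℝ ∞ (fun y => metricInChart g x₀ y i j) (extChartAt 𝓘(ℝ, Coord n) x₀).target :=
  contDiffOn_metric g x₀ (stdVec i) (stdVec j)

/-! ### The bundle map `⋆' ⋆⁻¹` -/

lemma starChange_apply (g g' : Metric (Coord n) M) {r : ℕ} (η : FormField (Coord n) M r) (x : M) :
    starChange g g' η x = gramChange (metricAt g x) (metricAt g' x) (η x) :=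
  hodgeStar_invFun_hodgeStar (metricAt_posDef g x) (metricAt_posDef g' x) _

lemma starChange_starChange (g g' : Metric (Coord n) M) {r : ℕ} (η : FormField (Coord n) M r) :
    starChange g' g (starChange g g' η) = η := by
  funext x
  rw [starChange_apply, starChange_apply]
  exact gramChange_gramChange (metricAt_posDef g x) (metricAt_posDef g' x) _

variable (M) in
/-- The bundle map `⋆' ⋆⁻¹` as a linear isomorphism of the space of fields of forms. -/
def starChangeEquiv (g g' : Metric (Coord n) M) (r : ℕ) :
    FormField (Coord n) M r ≃ₗ[ℝ] FormField (Coord n) M r where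
  toFun := starChange g g'
  invFun := starChange g' g
  left_inv := starChange_starChange g g'
  right_inv := starChange_starChange g' g
  map_add' η θ := by
    funext x
    simp only [FormField.add_apply, starChange_apply]
    exact gramChange_add _ _
  map_smul' c η := by
    funext x
    simp only [FormField.smul_apply, starChange_apply]
    exact gramChange_smul _ _

/-- At a point `p` the bundle map is computed in the basis of the chart at `p`, its expression in
the chart at `x₀` in another basis. `gramChange_conj`, with `P` the change of basis, identifies the
two. -/
lemma inChart_starChange (g g' : Metric (Coord n) M) {r : ℕ} (η : FormField (Coord n) M r)
    (x₀ : M) {y : Coord n} (hy : y ∈ (extChartAt 𝓘(ℝ, Coord n) x₀).target) :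
    inChart x₀ (starChange g g' η) y =
      gramChange (metricInChart g x₀ y) (metricInChart g' x₀ y) (inChart x₀ η y) := by
  rw [inChart_eq, inChart_eq, metricInChart_eq, metricInChart_eq]
  exact (congrArg (matPullback _) (starChange_apply g g' η _)).trans
    (gramChange_conj (det_paramMatrix_ne_zero x₀ hy) (metricAt_posDef g _).det_pos.ne' _).symm

lemma starChange_mem_smoothForms (g g' : Metric (Coord n) M) {r : ℕ}
    {η : FormField (Coord n) M r} (hη : η ∈ smoothForms (Coord n) M r) :
    starChange g g' η ∈ smoothForms (Coord n) M r := fun x₀ =>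
  (contDiffOn_gramChange (contDiffOn_metricInChart g x₀) (contDiffOn_metricInChart g' x₀)
    (fun _ hy => det_metricInChart_ne_zero g x₀ hy)
    (fun _ hy => det_metricInChart_ne_zero g' x₀ hy) (hη x₀)).congr
    fun _ hy => inChart_starChange g g' η x₀ hy

lemma starChange_mem_compactlySupported (g g' : Metric (Coord n) M) {r : ℕ}
    {η : FormField (Coord n) M r} (hη : η ∈ compactlySupported (Coord n) M r) :
    starChange g g' η ∈ compactlySupported (Coord n) M r := by
  obtain ⟨K, hK, h0⟩ := hη
  refine ⟨K, hK, fun x hx => ?_⟩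
  rw [starChange_apply, h0 x hx]
  exact gramChange_zero

/-- The bundle map `⋆' ⋆⁻¹` intertwines the codifferentials. -/
lemma codiff_starChange (g g' : Metric (Coord n) M) {r : ℕ}
    (η : FormField (Coord n) M (r + 1)) :
    codiff g' (starChange g g' η) = starChange g g' (codiff g η) := by
  funext x
  -- By `⋆' B = ⋆` the forms under `d` coincide. The exterior derivative needs this on a
  -- neighbourhood, not just at the point; the outer star is then handled pointwise by `B ⋆ = ⋆'`.
  have h1 : (fun y => hodgeStar (metricInChart g' x y) (r + 1) (n - (r + 1))
        (inChart x (starChange g g' η) y)) =ᶠ[𝓝 (extChartAt 𝓘(ℝ, Coord n) x x)]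
      fun y => hodgeStar (metricInChart g x y) (r + 1) (n - (r + 1)) (inChart x η y) := by
    filter_upwards [extChartAt_target_mem_nhds x] with y hy
    rw [inChart_starChange g g' η x hy,
      hodgeStar_gramChange (metricInChart_posDef g x hy) (metricInChart_posDef g' x hy)]
  have h2 (β : AltForm n r) : ContinuousAlternatingMap.compContinuousLinearMap β
      (chartDeriv x x : Coord n →L[ℝ] Coord n) = β := by
    rw [chartDeriv_self]
    rfl
  rw [starChange_apply]
  simp only [codiff]
  erw [h2, h2]
  rw [h1.extDeriv_eq, gramChange_smul, metricInChart_self, metricInChart_self,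
    gramChange_hodgeStar (metricAt_posDef g x) (metricAt_posDef g' x)]

/-! ### Passage to cohomology -/

lemma starChange_mem_coclosedForms (g g' : Metric (Coord n) M) {r : ℕ}
    {η : FormField (Coord n) M r} (hη : η ∈ coclosedForms g r) :
    starChange g g' η ∈ coclosedForms g' r := by
  cases r with
  | zero => exact starChange_mem_smoothForms g g' hη
  | succ r =>
    refine ⟨starChange_mem_smoothForms g g' hη.1, ?_⟩
    rw [codiff_starChange, hη.2]
    exact map_zero (starChangeEquiv M g g' r)

lemma starChange_mem_codiffImage (g g' : Metric (Coord n) M) {r : ℕ}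
    {W W' : Submodule ℝ (FormField (Coord n) M (r + 1))}
    (hW : ∀ η ∈ W, starChange g g' η ∈ W') {θ : FormField (Coord n) M r}
    (hθ : θ ∈ codiffImage g W) : starChange g g' θ ∈ codiffImage g' W' := by
  obtain ⟨η, hη, hs, rfl⟩ := hθ
  exact ⟨starChange g g' η, hW η hη, starChange_mem_smoothForms g g' hs, codiff_starChange g g' η⟩

/-- If `⋆' ⋆⁻¹` identifies two graded spaces of forms, it identifies their cohomologies. -/
theorem exists_cohomology_equiv (g g' : Metric (Coord n) M)
    (W W' : (r : ℕ) → Submodule ℝ (FormField (Coord n) M r))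
    (hW : ∀ r, ∀ η ∈ W r, starChange g g' η ∈ W' r)
    (hW' : ∀ r, ∀ η ∈ W' r, starChange g' g η ∈ W r) (r : ℕ) :
    ∃ Φ : Cohomology W g r ≃ₗ[ℝ] Cohomology W' g' r,
      ∀ ψ : cocycles W g r, ∃ h : starChange g g' ψ.1 ∈ cocycles W' g' r,
        Φ (cohomologyClass W g r ψ) = cohomologyClass W' g' r ⟨starChange g g' ψ.1, h⟩ := by
  have hc : ∀ ψ ∈ cocycles W g r, starChange g g' ψ ∈ cocycles W' g' r := fun ψ hψ =>
    ⟨hW r ψ hψ.1, starChange_mem_coclosedForms g g' hψ.2⟩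
  have hc' : ∀ ψ ∈ cocycles W' g' r, starChange g' g ψ ∈ cocycles W g r := fun ψ hψ =>
    ⟨hW' r ψ hψ.1, starChange_mem_coclosedForms g' g hψ.2⟩
  let e : cocycles W g r ≃ₗ[ℝ] cocycles W' g' r :=
    LinearEquiv.ofLinearMap
      ((starChangeEquiv M g g' r).toLinearMap.restrict hc)
      ((starChangeEquiv M g' g r).toLinearMap.restrict hc')
      (by ext1 ψ; exact Subtype.ext (starChange_starChange g' g ψ.1))
      (by ext1 ψ; exact Subtype.ext (starChange_starChange g g' ψ.1))
  -- Coboundaries correspond because a primitive is carried to a primitive; the reverse inclusion is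
  -- the same argument with the metrics exchanged.
  have he : ((codiffImage g (W (r + 1))).comap (cocycles W g r).subtype).map e.toLinearMap =
      (codiffImage g' (W' (r + 1))).comap (cocycles W' g' r).subtype := by
    ext θ
    constructor
    · rintro ⟨ψ, hψ, rfl⟩
      exact starChange_mem_codiffImage g g' (hW (r + 1)) hψ
    · intro hθ
      exact ⟨e.symm θ, starChange_mem_codiffImage g' g (hW' (r + 1)) hθ, e.apply_symm_apply θ⟩
  exact ⟨Submodule.Quotient.equiv _ _ e he, fun ψ => ⟨hc ψ.1 ψ.2, rfl⟩⟩

end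

/-! ### Densities and suprema of measures -/

lemma withDensity_mono_measure {α : Type*} [MeasurableSpace α] {μ ν : Measure α} (h : μ ≤ ν)
    (f : α → ENNReal) : μ.withDensity f ≤ ν.withDensity f := by
  refine Measure.le_iff.2 fun s hs => ?_
  rw [withDensity_apply f hs, withDensity_apply f hs]
  exact lintegral_mono' (Measure.restrict_mono le_rfl h) le_rfl

/-- For a positive finite density, multiplication by `f` is a monotone bijection of measures with
monotone inverse, multiplication by `f⁻¹`. It therefore commutes with arbitrary suprema. -/
lemma withDensity_iSup {α ι : Type*} [MeasurableSpace α] (μ : ι → Measure α)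
    {f : α → ENNReal} (hf : Measurable f) (h0 : ∀ x, f x ≠ 0) (htop : ∀ x, f x ≠ ⊤) :
    (⨆ i, μ i).withDensity f = ⨆ i, (μ i).withDensity f := by
  refine le_antisymm ?_ (iSup_le fun i => withDensity_mono_measure (le_iSup μ i) f)
  have h1 : ⨆ i, μ i ≤ (⨆ i, (μ i).withDensity f).withDensity f⁻¹ := iSup_le fun i =>
    (withDensity_inv_same (μ := μ i) hf (.of_forall h0) (.of_forall htop)).ge.trans
      (withDensity_mono_measure (le_iSup (fun i => (μ i).withDensity f) i) _)
  have h2 (ν : Measure α) : (ν.withDensity f⁻¹).withDensity f = ν := by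
    have := withDensity_inv_same (μ := ν) (f := f⁻¹) hf.inv
      (.of_forall fun x => ENNReal.inv_ne_zero.2 (htop x))
      (.of_forall fun x => ENNReal.inv_ne_top.2 (h0 x))
    simpa only [Pi.inv_apply, inv_inv] using this
  exact (withDensity_mono_measure h1 f).trans_eq (h2 _)

/-- Almost everywhere measurability of `φ` is the right generality: an inverse chart is controlled
only on the target of the chart. -/
lemma map_withDensity_of_comp {α β : Type*} [MeasurableSpace α] [MeasurableSpace β]
    {μ : Measure α} {φ : α → β} (hφ : AEMeasurable φ μ) {f : β → ENNReal} (hf : Measurable f) :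
    (μ.withDensity fun a => f (φ a)).map φ = (μ.map φ).withDensity f := by
  have hφ' : AEMeasurable φ (μ.withDensity fun a => f (φ a)) :=
    hφ.mono_ac (withDensity_absolutelyContinuous _ _)
  ext s hs
  rw [Measure.map_apply_of_aemeasurable hφ' hs, withDensity_apply f hs,
    Measure.restrict_map_of_aemeasurable hφ hs, lintegral_map' hf.aemeasurable
      (hφ.mono_measure Measure.restrict_le_self)]
  exact withDensity_apply₀ _ (hφ.nullMeasurableSet_preimage hs)

section

variable {n : ℕ} {M : Type*} [TopologicalSpace M] [ChartedSpace (Coord n) M]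
  [IsManifold 𝓘(ℝ, Coord n) ∞ M]

/-! ### The change of the Riemannian volume -/

/-- The density of the volume of `g'` with respect to the volume of `g`. -/
def volumeRatio (g g' : Metric (Coord n) M) (x : M) : ℝ :=
  √((metricAt g' x).det / (metricAt g x).det)

lemma volumeRatio_pos (g g' : Metric (Coord n) M) (x : M) : 0 < volumeRatio g g' x :=
  Real.sqrt_pos.2 (div_pos (metricAt_posDef g' x).det_pos (metricAt_posDef g x).det_pos)

/-- Changing the basis multiplies both Gram determinants by the same `(det P)²`, so their ratio may
be computed in any chart. -/
lemma volumeRatio_extChartAt_symm (g g' : Metric (Coord n) M) (x₀ : M) {y : Coord n}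
    (hy : y ∈ (extChartAt 𝓘(ℝ, Coord n) x₀).target) :
    volumeRatio g g' ((extChartAt 𝓘(ℝ, Coord n) x₀).symm y) =
      √((metricInChart g' x₀ y).det / (metricInChart g x₀ y).det) := by
  have h := det_paramMatrix_ne_zero x₀ hy
  rw [volumeRatio, metricInChart_eq, metricInChart_eq]
  congr 1
  simp only [Matrix.det_mul, Matrix.det_transpose]
  field_simp

/-- The matrices `metricAt g x` refer to a chart that varies with `x` and need not be continuous in
`x`. Their ratio of determinants is, being equal near each point to the ratio in one fixed chart. -/
lemma continuous_volumeRatio (g g' : Metric (Coord n) M) : Continuous (volumeRatio g g') := by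
  refine continuous_iff_continuousAt.2 fun x => ?_
  have h1 : ContinuousOn
      (fun y => √((metricInChart g' x y).det / (metricInChart g x y).det))
      (extChartAt 𝓘(ℝ, Coord n) x).target :=
    ((contDiffOn_det (contDiffOn_metricInChart g' x)).continuousOn.div
      (contDiffOn_det (contDiffOn_metricInChart g x)).continuousOn
      fun y hy => det_metricInChart_ne_zero g x hy).sqrt
  have h2 := (h1.continuousAt (extChartAt_target_mem_nhds x)).comp
    (continuousAt_extChartAt (I := 𝓘(ℝ, Coord n)) x)
  refine h2.congr ?_
  filter_upwards [extChartAt_source_mem_nhds (I := 𝓘(ℝ, Coord n)) x] with z hz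
  have h3 := volumeRatio_extChartAt_symm g g' x ((extChartAt 𝓘(ℝ, Coord n) x).map_source hz)
  rw [(extChartAt 𝓘(ℝ, Coord n) x).left_inv hz] at h3
  exact h3.symm

/-- The pointwise form of `⟨Bα, β⟩' dvol' = ⟨α, β⟩ dvol`: the volume ratio cancels the factor from
`formInner_gramChange`. -/
lemma volumeRatio_smul_pointInner (g g' : Metric (Coord n) M) {r : ℕ}
    (α β : FormField (Coord n) M r) (x : M) :
    (volumeRatio g g' x).toNNReal • pointInner g' (starChange g g' α) β x =
      pointInner g α β x := by
  have h1 := (metricAt_posDef g x).det_pos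
  have h2 := (metricAt_posDef g' x).det_pos
  rw [NNReal.smul_def, Real.coe_toNNReal _ (volumeRatio_pos g g' x).le, pointInner,
    starChange_apply, volumeRatio, smul_eq_mul]
  erw [formInner_gramChange (metricAt_posDef g x) (metricAt_posDef g' x)]
  rw [← mul_assoc, ← Real.sqrt_mul (div_pos h2 h1).le, div_mul_div_cancel₀ h1.ne',
    div_self h2.ne', Real.sqrt_one, one_mul]
  rfl

variable [MeasurableSpace M] [BorelSpace M]

lemma measurable_volumeRatio (g g' : Metric (Coord n) M) :
    Measurable fun x => (volumeRatio g g' x).toNNReal :=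
  (continuous_volumeRatio g g').measurable.real_toNNReal

lemma chartVolume_eq_withDensity (g g' : Metric (Coord n) M) (x₀ : M) :
    chartVolume g' x₀ =
      (chartVolume g x₀).withDensity fun x => ((volumeRatio g g' x).toNNReal : ENNReal) := by
  have htarget : MeasurableSet (extChartAt 𝓘(ℝ, Coord n) x₀).target :=
    (isOpen_extChartAt_target x₀).measurableSet
  have hφ : AEMeasurable (extChartAt 𝓘(ℝ, Coord n) x₀).symm
      (volume.restrict (extChartAt 𝓘(ℝ, Coord n) x₀).target) :=
    (continuousOn_extChartAt_symm x₀).aemeasurable htarget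
  have hdens (g : Metric (Coord n) M) : AEMeasurable
      (fun y => ENNReal.ofReal √(metricInChart g x₀ y).det)
      (volume.restrict (extChartAt 𝓘(ℝ, Coord n) x₀).target) :=
    ((contDiffOn_det (contDiffOn_metricInChart g x₀)).continuousOn.sqrt.aemeasurable
      htarget).ennreal_ofReal
  have hf := (measurable_volumeRatio g g').coe_nnreal_ennreal
  rw [chartVolume, chartVolume, ← map_withDensity_of_comp
    (hφ.mono_ac (withDensity_absolutelyContinuous _ _)) hf]
  congr 1
  refine Eq.trans ?_ (withDensity_mul₀ (hdens g) (hf.comp_aemeasurable hφ))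
  refine withDensity_congr_ae ?_
  filter_upwards [ae_restrict_mem htarget] with y hy
  have h1 := (metricInChart_posDef g x₀ hy).det_pos
  have h2 := (metricInChart_posDef g' x₀ hy).det_pos
  rw [Pi.mul_apply]
  change _ = _ * ENNReal.ofReal (volumeRatio g g' _)
  rw [volumeRatio_extChartAt_symm g g' x₀ hy, ← ENNReal.ofReal_mul (Real.sqrt_nonneg _),
    ← Real.sqrt_mul h1.le, mul_div_cancel₀ _ h1.ne']

/-- The density is one global function serving all charts, so it passes through the supremum;
agreement of the chart volumes on overlaps plays no role. -/
lemma riemannianVolume_eq_withDensity (g g' : Metric (Coord n) M) :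
    riemannianVolume g' =
      (riemannianVolume g).withDensity fun x => ((volumeRatio g g' x).toNNReal : ENNReal) := by
  rw [riemannianVolume, riemannianVolume, withDensity_iSup _
    (measurable_volumeRatio g g').coe_nnreal_ennreal _ fun x => ENNReal.coe_ne_top]
  · exact iSup_congr (chartVolume_eq_withDensity g g')
  · intro x
    simpa using volumeRatio_pos g g' x

/-! ### Antibasic forms for two metrics -/

/-- After the change of measure the integrand is literally the old one, so absolute convergence and
vanishing of the integral transfer together. -/
lemma L2Orthogonal.starChange {g : Metric (Coord n) M} {r : ℕ} {α β : FormField (Coord n) M r}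
    (h : L2Orthogonal g α β) (g' : Metric (Coord n) M) :
    L2Orthogonal g' (starChange g g' α) β := by
  have hm := measurable_volumeRatio g g'
  rw [L2Orthogonal, riemannianVolume_eq_withDensity g g',
    integrable_withDensity_iff_integrable_smul hm, integral_withDensity_eq_integral_smul hm]
  simp only [volumeRatio_smul_pointInner]
  exact h

/-- The test forms `β` are the same for both metrics, because `basicForms` involves none; no other
property of the foliation enters. -/
lemma Foliation.starChange_mem_antibasicForms {p : ℕ} (F : Foliation n p M)
    (g g' : Metric (Coord n) M) (r : ℕ) :
    ∀ η ∈ F.antibasicForms g r, starChange g g' η ∈ F.antibasicForms g' r := fun _ hη =>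
  ⟨starChange_mem_smoothForms g g' hη.1, fun β hβ => (hη.2 β hβ).starChange g'⟩

lemma Foliation.starChange_mem_compactAntibasicForms {p : ℕ} (F : Foliation n p M)
    (g g' : Metric (Coord n) M) (r : ℕ) :
    ∀ η ∈ F.compactAntibasicForms g r, starChange g g' η ∈ F.compactAntibasicForms g' r :=
  fun η hη => ⟨F.starChange_mem_antibasicForms g g' r η hη.1,
    starChange_mem_compactlySupported g g' hη.2⟩

end

end AntibasicCohomology

end

open AntibasicCohomology in
theorem mainTheorem1 {n p : ℕ} {M : Type*} [TopologicalSpace M] [T2Space M]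
    [SecondCountableTopology M] [ChartedSpace (Coord n) M] [IsManifold 𝓘(ℝ, Coord n) ∞ M]
    [MeasurableSpace M] [BorelSpace M] (F : Foliation n p M) (g g' : Metric (Coord n) M) (r : ℕ) :
    (∃ Φ : antibasicCohomology F g r ≃ₗ[ℝ] antibasicCohomology F g' r,
      ∀ ψ : cocycles (F.antibasicForms g) g r,
        ∃ h : starChange g g' ψ.1 ∈ cocycles (F.antibasicForms g') g' r,
          Φ (cohomologyClass (F.antibasicForms g) g r ψ) =
            cohomologyClass (F.antibasicForms g') g' r ⟨starChange g g' ψ.1, h⟩) ∧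
    (∃ Φ : compactAntibasicCohomology F g r ≃ₗ[ℝ] compactAntibasicCohomology F g' r,
      ∀ ψ : cocycles (F.compactAntibasicForms g) g r,
        ∃ h : starChange g g' ψ.1 ∈ cocycles (F.compactAntibasicForms g') g' r,
          Φ (cohomologyClass (F.compactAntibasicForms g) g r ψ) =
            cohomologyClass (F.compactAntibasicForms g') g' r ⟨starChange g g' ψ.1, h⟩) := by
  exact ⟨exists_cohomology_equiv g g' _ _ (F.starChange_mem_antibasicForms g g')
      (F.starChange_mem_antibasicForms g' g) r,
    exists_cohomology_equiv g g' _ _ (F.starChange_mem_compactAntibasicForms g g')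
      (F.starChange_mem_compactAntibasicForms g' g) r⟩
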